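/- **Setting.** For $k\ge 1$ equip $[-1,1]^k$ with the Euclidean distance. Consider finite-horizon MDPs with state space $\mathcal S=[-1,1]^{d_S}$, action space $\mathcal A=[-1,1]^{d_A}$, horizon $H$, transition kernels $p_h(\cdot\mid s,a)$ and deterministic measurable rewards $R_h(s,a)\in[0,1]$, $h=1,\dots,H$; put $d=d_S+d_A$. Policies $\pi=(\pi_h)_{h\le H}$ are sequences of Markov kernels from $\mathcal S$ to $\mathcal A$; $V_1^\pi(s)$ is the expected sum of the $H$ rewards when $s_1=s$, $a_h\sim\pi_h(\cdot\mid s_h)$, $s_{h+1}\sim p_h(\cdot\mid s_h,a_h)$, and $V_1(s)=\sup_\pi V_1^\pi(s)$. A policy $\pi$ is $\varepsilon$-optimal if $\sup_{s\in\mathcal S}|V_1(s)-V_1^{\pi}(s)|\le\varepsilon$. The MDP is $(L_p,L_r)$-Lipschitz if for all $h,s,s',a,a'$ $$|R_h(s,a)-R_h(s',a')|\le L_r(\|s-s'\|_2+\|a-a'\|_2),\qquad \mathcal W\big(p_h(\cdot\mid s,a),p_h(\cdot\mid s',a')\big)\le L_p(\|s-s'\|_2+\|a-a'\|_2),$$ where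 $\mathcal W(\mu,\zeta)=\sup\{\int f\,d\mu-\int f\,d\zeta:\ f \text{ 1-Lipschitz}\}$ is the Wasserstein distance. An algorithm with $n$ samples makes $n$ calls to a generative model: it chooses, adaptively and possibly at random, triples $(s,a,h)$, each answered by $s'\sim p_h(\cdot\mid s,a)$ together with $R_h(s,a)$, and then returns a policy. It *learns an $\varepsilon$-optimal policy with probability at least $1-\delta$ in $(L_p,L_r)$-Lipschitz MDPs* if, for every such MDP (with the given $d_S,d_A,H$), the returned policy is $\varepsilon$-optimal with probability at least $1-\delta$. **Theorem.** 1. Let $d_S,d_A\ge1$, $L_0>0$ and $\delta_0\in(0,1)$. There are $c,\varepsilon_0>0$, depending only on $d_S,d_A,L_0,\delta_0$, such that for all $L_p,L_r\ge L_0$, all $H\ge2$, all $\varepsilon\in(0,\varepsilon_0]$ and all $\delta\in(0,\delta_0]$, every algorithm that learns an $\varepsilon$-optimal policy with probability at least $1-\delta$ in $(L_p,L_r)$-Lipschitz MDPs needs $$n\ \ge\ c\,L_p^{\,d(H-2)}\,\varepsilon^{-d-2}$$ samples. 2. In particular, for $L_p>1$ the cost is exponential in $dH$: there is $C>1$, depending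 only on $L_p$, such that for all $d_S,d_A\ge1$, $L_r>0$ and $\delta_0\in(0,1)$ there are $c,\varepsilon_0>0$ (depending on $L_p,d_S,d_A,L_r,\delta_0$) such that for all $H\ge 2$, $\varepsilon\in(0,\varepsilon_0]$ and $\delta\in(0,\delta_0]$ every such algorithm needs $n\ge c\,C^{dH}\varepsilon^{-d-2}$ samples. -/

import Mathlib

open MeasureTheory ProbabilityTheory

noncomputable section

namespace LipMDP

/-! ### Spaces and the Wasserstein distance -/

/-- The cube `[-1,1]^k` inside `ℝ^k` with its Euclidean norm. -/
def cube (k : ℕ) : Set (EuclideanSpace ℝ (Fin k)) :=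
  {x | ∀ i, x i ∈ Set.Icc (-1 : ℝ) 1}

/-- The cube `[-1,1]^k` as a metric space (Euclidean distance) with its Borel `σ`-algebra. -/
abbrev Cube (k : ℕ) : Type := cube k

/-- The Wasserstein distance of two probability measures on a bounded metric space, in its dual
form: the supremum of `∫ f d(μ - ν)` over all functions `f` with Lipschitz constant at most `1`.
(On a bounded space the supremum is over a bounded set.) -/
def wasserstein {X : Type*} [PseudoEMetricSpace X] [MeasurableSpace X] (μ ν : Measure X) : ℝ :=
  ⨆ f : {f : X → ℝ // LipschitzWith 1 f}, (∫ x, f.1 x ∂μ - ∫ x, f.1 x ∂ν)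

/-! ### Finite sequences of observations -/

/-- `Hist X Y k` is the space `X × Y × ⋯ × Y` (`k` copies of `Y`): a starting datum in `X`
followed by `k` observations in `Y`. -/
def Hist (X : Type*) (Y : Type) : ℕ → Type _
  | 0 => X
  | k + 1 => Hist X Y k × Y

/-- The product `σ`-algebra on `Hist X Y k`. -/
instance Hist.instMeasurableSpace {X : Type*} {Y : Type} [mX : MeasurableSpace X]
    [mY : MeasurableSpace Y] : (k : ℕ) → MeasurableSpace (Hist X Y k)
  | 0 => mX
  | k + 1 => @Prod.instMeasurableSpace _ _ (Hist.instMeasurableSpace k) mY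

/-- The joint law of a starting datum with law `μ` and of `k ≤ n` successive observations, the
observation number `t` having conditional law `κ t` given all that precedes it. -/
def histLaw {X : Type*} {Y : Type} [MeasurableSpace X] [MeasurableSpace Y] {n : ℕ}
    (μ : Measure X) (κ : (t : Fin n) → Kernel (Hist X Y t) Y) :
    (k : ℕ) → k ≤ n → Measure (Hist X Y k)
  | 0, _ => μ
  | k + 1, h => (histLaw μ κ k (Nat.le_of_succ_le h)).compProd (κ ⟨k, h⟩)

theorem isProbabilityMeasure_histLaw {X : Type*} {Y : Type} [MeasurableSpace X]
    [MeasurableSpace Y] {n : ℕ} (μ : Measure X) [IsProbabilityMeasure μ]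
    (κ : (t : Fin n) → Kernel (Hist X Y t) Y) (hκ : ∀ t, IsMarkovKernel (κ t)) :
    (k : ℕ) → (h : k ≤ n) → IsProbabilityMeasure (histLaw μ κ k h)
  | 0, _ => ‹IsProbabilityMeasure μ›
  | k + 1, h => by
    have := isProbabilityMeasure_histLaw μ κ hκ k (Nat.le_of_succ_le h)
    have := hκ ⟨k, h⟩
    exact (inferInstance : IsProbabilityMeasure
      ((histLaw μ κ k (Nat.le_of_succ_le h)).compProd (κ ⟨k, h⟩)))

/-! ### Markov decision processes -/

/-- A finite-horizon Markov decision process with state space `[-1,1]^dS`, action space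
`[-1,1]^dA` and horizon `H`. The stages `1, …, H` are indexed by `Fin H`; rewards are
deterministic functions of state, action and stage, with values in `[0,1]`. -/
structure MDP (dS dA H : ℕ) where
  /-- the transition probabilities `p_h(· | s, a)` -/
  trans : Fin H → Kernel (Cube dS × Cube dA) (Cube dS)
  trans_markov : ∀ h, IsMarkovKernel (trans h)
  /-- the rewards `R_h(s, a)` -/
  reward : Fin H → Cube dS × Cube dA → ℝ
  reward_measurable : ∀ h, Measurable (reward h)
  reward_mem : ∀ h z, reward h z ∈ Set.Icc (0 : ℝ) 1

/-- A policy: for every stage, a Markov kernel from states to actions. -/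
structure Policy (dS dA H : ℕ) where
  act : Fin H → Kernel (Cube dS) (Cube dA)
  act_markov : ∀ h, IsMarkovKernel (act h)

/-- The last state of a trajectory `s₁, (a₁, s₂), …, (a_k, s_{k+1})`. -/
def lastState {dS dA : ℕ} : (k : ℕ) → Hist (Cube dS) (Cube dA × Cube dS) k → Cube dS
  | 0, s => s
  | _ + 1, x => x.2.2

theorem measurable_lastState {dS dA : ℕ} :
    (k : ℕ) → Measurable (lastState (dS := dS) (dA := dA) k)
  | 0 => measurable_id
  | k + 1 => by
    have h : Measurable fun x : Hist (Cube dS) (Cube dA × Cube dS) k × (Cube dA × Cube dS) =>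
        x.2.2 := measurable_snd.snd
    exact h

namespace MDP

variable {dS dA H : ℕ}

/-- The transitions and rewards are Lipschitz with constants `Lp` and `Lr`. -/
structure IsLipschitz (M : MDP dS dA H) (Lp Lr : ℝ) : Prop where
  reward_le : ∀ (h : Fin H) (s s' : Cube dS) (a a' : Cube dA),
    |M.reward h (s, a) - M.reward h (s', a')| ≤ Lr * (dist s s' + dist a a')
  trans_le : ∀ (h : Fin H) (s s' : Cube dS) (a a' : Cube dA),
    wasserstein (M.trans h (s, a)) (M.trans h (s', a')) ≤ Lp * (dist s s' + dist a a')

/-- One stage under a policy: in state `s`, draw `a ∼ π_h(· | s)`, then `s' ∼ p_h(· | s, a)`. -/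
def stepKernel (M : MDP dS dA H) (π : Policy dS dA H) (h : Fin H) :
    Kernel (Cube dS) (Cube dA × Cube dS) :=
  (π.act h).compProd (M.trans h)

/-- The law of the trajectory `s₁ = s, (a₁, s₂), …, (a_H, s_{H+1})` under the policy `π`. -/
def trajLaw (M : MDP dS dA H) (π : Policy dS dA H) (s : Cube dS) :
    Measure (Hist (Cube dS) (Cube dA × Cube dS) H) :=
  histLaw (Measure.dirac s)
    (fun h : Fin H => (M.stepKernel π h).comap (lastState (h : ℕ)) (measurable_lastState _))
    H le_rfl

/-- The sum of the rewards collected along the first `k` stages of a trajectory. -/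
def totalReward (M : MDP dS dA H) :
    (k : ℕ) → k ≤ H → Hist (Cube dS) (Cube dA × Cube dS) k → ℝ
  | 0, _, _ => 0
  | k + 1, h, x =>
    M.totalReward k (Nat.le_of_succ_le h) x.1 + M.reward ⟨k, h⟩ (lastState k x.1, x.2.1)

/-- The value `V₁^π(s)`: the expected sum of the rewards of all `H` stages from `s₁ = s`. -/
def value (M : MDP dS dA H) (π : Policy dS dA H) (s : Cube dS) : ℝ :=
  ∫ x, M.totalReward H le_rfl x ∂(M.trajLaw π s)

/-- The optimal value `V₁(s)`, the supremum of `V₁^π(s)` over all policies. -/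
def optValue (M : MDP dS dA H) (s : Cube dS) : ℝ :=
  ⨆ π : Policy dS dA H, M.value π s

/-- `π` is `ε`-optimal: `sup_s |V₁(s) - V₁^π(s)| ≤ ε`. -/
def IsEpsOptimal (M : MDP dS dA H) (ε : ℝ) (π : Policy dS dA H) : Prop :=
  ∀ s : Cube dS, |M.optValue s - M.value π s| ≤ ε

/-- The generative model: a query `((s, a), h)` is answered by a pair `(s', r)` with
`s' ∼ p_h(· | s, a)` and `r = R_h(s, a)`. -/
def generative (M : MDP dS dA H) :
    Kernel ((Cube dS × Cube dA) × Fin H) (Cube dS × ℝ) where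
  toFun q := (M.trans q.2).prod
    (Kernel.deterministic (M.reward q.2) (M.reward_measurable q.2)) q.1
  measurable' := measurable_from_prod_countable_left fun h =>
    ((M.trans h).prod (Kernel.deterministic (M.reward h) (M.reward_measurable h))).measurable

end MDP

/-! ### Learning algorithms -/

/-- A learning algorithm which calls the generative model `n` times. It draws a random seed; the
query number `t` is a measurable function of the seed and of the previous answers, and the policy
that is returned depends measurably on the seed and on all `n` answers. -/
structure Algorithm (dS dA H n : ℕ) (Ω : Type*) [MeasurableSpace Ω] where
  seed : Measure Ω
  seed_prob : IsProbabilityMeasure seed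
  query : (t : Fin n) → Hist Ω (Cube dS × ℝ) t → (Cube dS × Cube dA) × Fin H
  query_measurable : ∀ t, Measurable (query t)
  output : Fin H → Kernel (Hist Ω (Cube dS × ℝ) n × Cube dS) (Cube dA)
  output_markov : ∀ h, IsMarkovKernel (output h)

namespace Algorithm

variable {dS dA H n : ℕ} {Ω : Type*} [MeasurableSpace Ω]

/-- The joint law of the seed and of the `n` answers when the algorithm is run on `M`. -/
def law (alg : Algorithm dS dA H n Ω) (M : MDP dS dA H) :
    Measure (Hist Ω (Cube dS × ℝ) n) :=
  histLaw alg.seed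
    (fun t : Fin n => M.generative.comap (alg.query t) (alg.query_measurable t)) n le_rfl

/-- The policy that the algorithm returns after it has seen `x`. -/
def policy (alg : Algorithm dS dA H n Ω) (x : Hist Ω (Cube dS × ℝ) n) : Policy dS dA H where
  act h := (alg.output h).comap (fun s => (x, s)) measurable_prodMk_left
  act_markov h := by
    have := alg.output_markov h
    infer_instance

/-- On every `(Lp, Lr)`-Lipschitz MDP, the algorithm returns an `ε`-optimal policy with
probability at least `1 - δ`. (The event is an intersection of measurable events over all starting
states; if it fails to be measurable, its probability is read as an outer measure, which only
enlarges the class of algorithms.) -/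
def LearnsLipschitz (alg : Algorithm dS dA H n Ω) (Lp Lr ε δ : ℝ) : Prop :=
  ∀ M : MDP dS dA H, M.IsLipschitz Lp Lr →
    ENNReal.ofReal (1 - δ) ≤ alg.law M {x | M.IsEpsOptimal ε (alg.policy x)}

end Algorithm

end LipMDP

end

/-! The hard instances toss one coin at the first transition and move deterministically afterwards.
The coin has bias `X` near a hidden centre in the state-action cube and is fair away from it. A
single reward, `ρ` after heads and `0` after tails, is paid at a later stage. The policy enters its
value only through the mean bias of its first action, so with `ρ * X = 2 * ε` an `ε`-optimal policy
must, from the centre's state, act near the centre's action with probability at least `1/2`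
(`half_le_of_isEpsOptimal`).

The exponential factor comes from the Wasserstein condition: it restricts only the slope of the bias
times the distance of the two outcomes (`CoinData.isLipschitz_toMDP`). Outcomes at distance `Lp ^
(-(j - 1))` permit a slope of order `Lp ^ (j - 1)`, and `j - 1` expansions by `Lp` bring this
distance back to `1` before the reward is paid. The bumps then have radius of order `ε / Lp ^ (j -
1)`, so about `(Lp ^ (j - 1) / ε) ^ d` of them fit into the cube with disjoint supports. The last
stage, `j = H - 1`, gives the exponent `H - 2`.

Every instance is compared with the fair coin. A query reveals relative entropy at most `3 * X ^ 2`,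
and about at most one of the instances (`sum_info_le`). Under the fair coin the output can favour
only few action centres for each state centre. Summing the change of measure `histLaw_le_of_cost`
over all instances (`card_le_of_learns`) forces `n` to be of order (number of bumps) `/ X ^ 2`, that
is `Lp ^ (d * (H - 2)) * ε ^ (-d - 2)`. -/

noncomputable section

namespace LipMDP

/-! ### Change of measure along a sequence of observations -/

section ChangeOfMeasure

variable {X : Type*} {Y : Type} {n : ℕ}

/-- The sum of the costs `D t` of the first `k` observations. -/
def cumulCost (D : (t : Fin n) → Hist X Y t → ENNReal) : (k : ℕ) → k ≤ n → Hist X Y k → ENNReal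
  | 0, _, _ => 0
  | k + 1, h, x => cumulCost D k (Nat.le_of_succ_le h) x.1 + D ⟨k, h⟩ x.1

theorem measurable_cumulCost [MeasurableSpace X] [MeasurableSpace Y]
    {D : (t : Fin n) → Hist X Y t → ENNReal} (hD : ∀ t, Measurable (D t)) :
    (k : ℕ) → (h : k ≤ n) → Measurable (cumulCost D k h)
  | 0, _ => measurable_const
  | k + 1, h => by
    have h1 := measurable_cumulCost hD k (Nat.le_of_succ_le h)
    have h2 : Measurable fun x : Hist X Y k × Y =>
        cumulCost D k (Nat.le_of_succ_le h) x.1 + D ⟨k, h⟩ x.1 :=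
      (h1.comp measurable_fst).add ((hD ⟨k, h⟩).comp measurable_fst)
    exact h2

theorem sum_cumulCost_le {ι : Type*} [Fintype ι]
    {D : ι → (t : Fin n) → Hist X Y t → ENNReal} {B : ENNReal}
    (hD : ∀ t x, ∑ i, D i t x ≤ B) :
    (k : ℕ) → (h : k ≤ n) → ∀ x, ∑ i, cumulCost (D i) k h x ≤ k * B
  | 0, _, _ => by simp [cumulCost]
  | k + 1, h, x => by
    have h1 := sum_cumulCost_le hD k (Nat.le_of_succ_le h) x.1
    simp only [cumulCost, Finset.sum_add_distrib]
    calc _ ≤ (k : ENNReal) * B + B := add_le_add h1 (hD _ _)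
      _ = _ := by push_cast; ring

variable [MeasurableSpace X] [MeasurableSpace Y]

/-- The chain rule for relative entropy. As a likelihood ratio has mean `1`, the integral of `L - 1
- log L` under the reference law is the relative entropy; this integrand is nonnegative, so no
integrability has to be checked. The free factor `c` in `h_cost` is the ratio accumulated so far. -/
theorem exists_likelihoodRatio (μ : Measure X) [IsProbabilityMeasure μ]
    {κ₀ κ₁ : (t : Fin n) → Kernel (Hist X Y t) Y}
    (hκ₀ : ∀ t, IsMarkovKernel (κ₀ t)) (hκ₁ : ∀ t, IsMarkovKernel (κ₁ t))
    {ℓ : (t : Fin n) → Hist X Y t × Y → ℝ} (hℓ : ∀ t, Measurable (ℓ t))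
    (hℓ_pos : ∀ t x, 0 < ℓ t x)
    {D : (t : Fin n) → Hist X Y t → ENNReal} (hD : ∀ t, Measurable (D t))
    (h_density : ∀ t x (F : Y → ENNReal), Measurable F →
      ∫⁻ y, F y ∂(κ₁ t x) = ∫⁻ y, F y * ENNReal.ofReal (ℓ t (x, y)) ∂(κ₀ t x))
    (h_cost : ∀ t x (c : ℝ), 0 < c →
      ∫⁻ y, ENNReal.ofReal (c * ℓ t (x, y) - 1 - Real.log (c * ℓ t (x, y))) ∂(κ₀ t x)
        ≤ ENNReal.ofReal (c - 1 - Real.log c) + D t x) :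
    (k : ℕ) → (h : k ≤ n) → ∃ L : Hist X Y k → ℝ, Measurable L ∧ (∀ x, 0 < L x) ∧
      (∀ F : Hist X Y k → ENNReal, Measurable F →
        ∫⁻ x, F x ∂(histLaw μ κ₁ k h) = ∫⁻ x, F x * ENNReal.ofReal (L x) ∂(histLaw μ κ₀ k h)) ∧
      ∫⁻ x, ENNReal.ofReal (L x - 1 - Real.log (L x)) ∂(histLaw μ κ₀ k h)
        ≤ ∫⁻ x, cumulCost D k h x ∂(histLaw μ κ₀ k h)
  | 0, _ => ⟨fun _ => 1, measurable_const, fun _ => one_pos,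
      fun F _ => by simp [histLaw], by simp⟩
  | k + 1, h => by
    obtain ⟨L, hL, hL_pos, hL_density, hL_cost⟩ := exists_likelihoodRatio μ hκ₀ hκ₁ hℓ hℓ_pos hD
      h_density h_cost k (Nat.le_of_succ_le h)
    have hp₀ := isProbabilityMeasure_histLaw μ κ₀ hκ₀ k (Nat.le_of_succ_le h)
    have hp₁ := isProbabilityMeasure_histLaw μ κ₁ hκ₁ k (Nat.le_of_succ_le h)
    have hm₀ := hκ₀ ⟨k, h⟩
    have hm₁ := hκ₁ ⟨k, h⟩
    let L' : Hist X Y k × Y → ℝ := fun x => L x.1 * ℓ ⟨k, h⟩ x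
    have hL' : Measurable L' := (hL.comp measurable_fst).mul (hℓ ⟨k, h⟩)
    have key : ∀ κ : (t : Fin n) → Kernel (Hist X Y t) Y, (∀ t, IsMarkovKernel (κ t)) →
        ∀ G : Hist X Y k × Y → ENNReal, Measurable G →
        ∫⁻ x, G x ∂(histLaw μ κ (k + 1) h) =
          ∫⁻ x, ∫⁻ y, G (x, y) ∂(κ ⟨k, h⟩ x) ∂(histLaw μ κ k (Nat.le_of_succ_le h)) := by
      intro κ hκ G hG
      have := hκ ⟨k, h⟩
      have := isProbabilityMeasure_histLaw μ κ hκ k (Nat.le_of_succ_le h)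
      exact Measure.lintegral_compProd hG
    refine ⟨L', hL', fun x => mul_pos (hL_pos _) (hℓ_pos _ _), fun F hF => ?_, ?_⟩
    · have hF' : Measurable (fun x : Hist X Y k × Y => F x) := hF
      refine (key κ₁ hκ₁ F hF).trans ?_
      refine (hL_density _ hF'.lintegral_kernel_prod_right').trans ?_
      refine Eq.trans ?_ (key κ₀ hκ₀ (fun x => F x * ENNReal.ofReal (L' x))
        (hF'.mul hL'.ennreal_ofReal)).symm
      refine lintegral_congr fun x => ?_
      refine (congrArg (· * ENNReal.ofReal (L x)) (h_density ⟨k, h⟩ x (fun y => F (x, y))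
        (hF'.comp measurable_prodMk_left))).trans ?_
      refine (lintegral_mul_const _ ((hF'.comp measurable_prodMk_left).mul
          ((hℓ ⟨k, h⟩).comp measurable_prodMk_left).ennreal_ofReal)).symm.trans ?_
      refine lintegral_congr fun y => ?_
      simp only [L', ENNReal.ofReal_mul (hL_pos x).le, Pi.mul_apply, Function.comp_apply]
      rw [mul_assoc, mul_comm (ENNReal.ofReal (ℓ _ _))]
    · have hDk := hD ⟨k, h⟩
      have hC := measurable_cumulCost hD k (Nat.le_of_succ_le h)
      refine (key κ₀ hκ₀ (fun x => ENNReal.ofReal (L' x - 1 - Real.log (L' x)))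
        ((hL'.sub_const 1).sub hL'.log).ennreal_ofReal).trans_le ?_
      refine le_trans ?_ (key κ₀ hκ₀
        (fun x => cumulCost D k (Nat.le_of_succ_le h) x.1 + D ⟨k, h⟩ x.1)
        ((hC.comp measurable_fst).add (hDk.comp measurable_fst))).symm.le
      calc _ ≤ ∫⁻ x, ENNReal.ofReal (L x - 1 - Real.log (L x)) + D ⟨k, h⟩ x
              ∂(histLaw μ κ₀ k (Nat.le_of_succ_le h)) :=
            lintegral_mono fun x => h_cost ⟨k, h⟩ x (L x) (hL_pos x)
        _ ≤ ∫⁻ x, cumulCost D k (Nat.le_of_succ_le h) x + D ⟨k, h⟩ x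
              ∂(histLaw μ κ₀ k (Nat.le_of_succ_le h)) := by
            rw [lintegral_add_right _ hDk, lintegral_add_right _ hDk]
            gcongr
        _ = _ := by simp

/-- The tangent of `log` at `2` gives this, with `2 - 2 * log 2 > 0` to spare. -/
theorem le_two_add_two_mul {c : ℝ} (hc : 0 < c) : c ≤ 2 + 2 * (c - 1 - Real.log c) := by
  have h1 := Real.log_le_sub_one_of_pos (show 0 < c / 2 by positivity)
  have h2 : Real.log c = Real.log (c / 2) + Real.log 2 := by
    rw [Real.log_div hc.ne' two_ne_zero]; ring
  have h3 := Real.log_two_lt_d9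
  linarith

/-- Integrate `le_two_add_two_mul` for the likelihood ratio over `E`. Unlike Pinsker's inequality,
this bound is linear in the cost, so it can be summed over many alternatives. -/
theorem histLaw_le_of_cost (μ : Measure X) [IsProbabilityMeasure μ]
    {κ₀ κ₁ : (t : Fin n) → Kernel (Hist X Y t) Y}
    (hκ₀ : ∀ t, IsMarkovKernel (κ₀ t)) (hκ₁ : ∀ t, IsMarkovKernel (κ₁ t))
    {ℓ : (t : Fin n) → Hist X Y t × Y → ℝ} (hℓ : ∀ t, Measurable (ℓ t))
    (hℓ_pos : ∀ t x, 0 < ℓ t x)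
    {D : (t : Fin n) → Hist X Y t → ENNReal} (hD : ∀ t, Measurable (D t))
    (h_density : ∀ t x (F : Y → ENNReal), Measurable F →
      ∫⁻ y, F y ∂(κ₁ t x) = ∫⁻ y, F y * ENNReal.ofReal (ℓ t (x, y)) ∂(κ₀ t x))
    (h_cost : ∀ t x (c : ℝ), 0 < c →
      ∫⁻ y, ENNReal.ofReal (c * ℓ t (x, y) - 1 - Real.log (c * ℓ t (x, y))) ∂(κ₀ t x)
        ≤ ENNReal.ofReal (c - 1 - Real.log c) + D t x)
    (k : ℕ) (h : k ≤ n) {E : Set (Hist X Y k)} (hE : MeasurableSet E) :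
    histLaw μ κ₁ k h E
      ≤ 2 * histLaw μ κ₀ k h E + 2 * ∫⁻ x, cumulCost D k h x ∂(histLaw μ κ₀ k h) := by
  obtain ⟨L, hL, hL_pos, hL_density, hL_cost⟩ := exists_likelihoodRatio μ hκ₀ hκ₁ hℓ hℓ_pos hD
    h_density h_cost k h
  have hg : Measurable fun x => ENNReal.ofReal (L x - 1 - Real.log (L x)) :=
    ((hL.sub_const 1).sub hL.log).ennreal_ofReal
  calc histLaw μ κ₁ k h E = ∫⁻ x, E.indicator 1 x ∂(histLaw μ κ₁ k h) := by
        rw [lintegral_indicator_one hE]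
    _ = ∫⁻ x, E.indicator 1 x * ENNReal.ofReal (L x) ∂(histLaw μ κ₀ k h) :=
        hL_density _ (measurable_one.indicator hE)
    _ ≤ ∫⁻ x, 2 * E.indicator 1 x + 2 * ENNReal.ofReal (L x - 1 - Real.log (L x))
          ∂(histLaw μ κ₀ k h) := by
        refine lintegral_mono fun x => ?_
        by_cases hx : x ∈ E
        · have hg0 : 0 ≤ L x - 1 - Real.log (L x) := by
            linarith [Real.log_le_sub_one_of_pos (hL_pos x)]
          have := ENNReal.ofReal_le_ofReal (le_two_add_two_mul (hL_pos x))
          rw [ENNReal.ofReal_add (by norm_num) (by positivity),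
            ENNReal.ofReal_mul (by norm_num)] at this
          simpa [hx] using this
        · simp [hx]
    _ = 2 * histLaw μ κ₀ k h E
          + 2 * ∫⁻ x, ENNReal.ofReal (L x - 1 - Real.log (L x)) ∂(histLaw μ κ₀ k h) := by
        rw [lintegral_add_right _ (hg.const_mul 2), lintegral_const_mul _ hg,
          lintegral_const_mul _ (measurable_one.indicator hE), lintegral_indicator_one hE]
    _ ≤ _ := by gcongr

end ChangeOfMeasure

/-! ### Decision processes with a biased coin at the first stage -/

/-- A bias in `[0, 1/4]` of a coin, depending measurably on the state and the action. -/
structure Bias (dS dA : ℕ) where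
  toFun : Cube dS × Cube dA → ℝ
  measurable_toFun : Measurable toFun
  nonneg : ∀ q, 0 ≤ toFun q
  le_quarter : ∀ q, toFun q ≤ 1 / 4

instance {dS dA : ℕ} : Zero (Bias dS dA) :=
  ⟨⟨fun _ => 0, measurable_const, fun _ => le_rfl, fun _ => by norm_num⟩⟩

@[simp]
theorem Bias.zero_toFun {dS dA : ℕ} (q : Cube dS × Cube dA) :
    (0 : Bias dS dA).toFun q = 0 := rfl

/-- The data of a process which is deterministic after its first transition: the outcomes
`heads` and `tails` of the coin of the first stage, the map `next` that moves the state
afterwards, and the reward `rew` of the states at the stage with index `idx`. -/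
structure CoinData (dS : ℕ) where
  heads : Cube dS
  tails : Cube dS
  heads_ne_tails : heads ≠ tails
  next : Cube dS → Cube dS
  measurable_next : Measurable next
  rew : Cube dS → ℝ
  measurable_rew : Measurable rew
  rew_mem : ∀ s, rew s ∈ Set.Icc (0 : ℝ) 1
  idx : ℕ

variable {dS dA H : ℕ}

namespace CoinData

/-- The law of the toss of a coin with bias `b`. -/
def toss (S : CoinData dS) (b : Bias dS dA) : Kernel (Cube dS × Cube dA) (Cube dS) where
  toFun q := ENNReal.ofReal (1 / 2 + b.toFun q) • Measure.dirac S.heads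
    + ENNReal.ofReal (1 / 2 - b.toFun q) • Measure.dirac S.tails
  measurable' := by
    refine Measure.measurable_of_measurable_coe _ fun A _ => ?_
    simp only [Measure.coe_add, Measure.coe_smul, Pi.add_apply, Pi.smul_apply, smul_eq_mul]
    exact ((b.measurable_toFun.const_add _).ennreal_ofReal.mul_const _).add
      ((b.measurable_toFun.const_sub _).ennreal_ofReal.mul_const _)

theorem toss_apply (S : CoinData dS) (b : Bias dS dA) (q : Cube dS × Cube dA) :
    S.toss b q = ENNReal.ofReal (1 / 2 + b.toFun q) • Measure.dirac S.heads
      + ENNReal.ofReal (1 / 2 - b.toFun q) • Measure.dirac S.tails := rfl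

instance (S : CoinData dS) (b : Bias dS dA) : IsMarkovKernel (S.toss b) :=
  ⟨fun q => ⟨by
    have h1 := b.nonneg q
    have h2 := b.le_quarter q
    rw [toss_apply]
    simp only [Measure.coe_add, Measure.coe_smul, Pi.add_apply, Pi.smul_apply, measure_univ,
      smul_eq_mul, mul_one]
    rw [← ENNReal.ofReal_add (by linarith) (by linarith)]
    norm_num⟩⟩

theorem lintegral_toss (S : CoinData dS) (b : Bias dS dA) (q : Cube dS × Cube dA)
    (F : Cube dS → ENNReal) :
    ∫⁻ s, F s ∂(S.toss b q) = ENNReal.ofReal (1 / 2 + b.toFun q) * F S.heads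
      + ENNReal.ofReal (1 / 2 - b.toFun q) * F S.tails := by
  rw [toss_apply, lintegral_add_measure, lintegral_smul_measure, lintegral_smul_measure,
    lintegral_dirac, lintegral_dirac, smul_eq_mul, smul_eq_mul]

/-- The deterministic motion by `next`, whatever the action. -/
def move (S : CoinData dS) (dA : ℕ) : Kernel (Cube dS × Cube dA) (Cube dS) :=
  Kernel.deterministic (fun q => S.next q.1) (S.measurable_next.comp measurable_fst)

instance (S : CoinData dS) (dA : ℕ) : IsMarkovKernel (S.move dA) :=
  Kernel.isMarkovKernel_deterministic _

theorem move_apply (S : CoinData dS) (q : Cube dS × Cube dA) :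
    S.move dA q = Measure.dirac (S.next q.1) :=
  Kernel.deterministic_apply _ _

/-- The decision process: a toss of the coin, then deterministic motion, with a reward at one
stage only. -/
def toMDP (S : CoinData dS) (H : ℕ) (b : Bias dS dA) : MDP dS dA H where
  trans h := if (h : ℕ) = 0 then S.toss b else S.move dA
  trans_markov h := by split_ifs <;> infer_instance
  reward h q := if (h : ℕ) = S.idx then S.rew q.1 else 0
  reward_measurable h := by
    split_ifs
    · exact S.measurable_rew.comp measurable_fst
    · exact measurable_const
  reward_mem h q := by
    split_ifs
    · exact S.rew_mem _
    · simp

theorem toMDP_trans_zero (S : CoinData dS) (b : Bias dS dA) {h : Fin H} (hh : (h : ℕ) = 0) :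
    (S.toMDP H b).trans h = S.toss b := if_pos hh

theorem toMDP_trans_of_ne_zero (S : CoinData dS) (b : Bias dS dA) {h : Fin H}
    (hh : (h : ℕ) ≠ 0) :
    (S.toMDP H b).trans h = S.move dA := if_neg hh

end CoinData

theorem MDP.lintegral_generative (M : MDP dS dA H) (q : (Cube dS × Cube dA) × Fin H)
    {F : Cube dS × ℝ → ENNReal} (hF : Measurable F) :
    ∫⁻ y, F y ∂(M.generative q) = ∫⁻ s, F (s, M.reward q.2 q.1) ∂(M.trans q.2 q.1) := by
  have := M.trans_markov q.2
  have h : M.generative q = (M.trans q.2 q.1).prod (Measure.dirac (M.reward q.2 q.1)) := by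
    change ((M.trans q.2).prod
      (Kernel.deterministic (M.reward q.2) (M.reward_measurable q.2))) q.1 = _
    rw [Kernel.prod_apply, Kernel.deterministic_apply]
  rw [h, lintegral_prod _ hF.aemeasurable]
  refine lintegral_congr fun s => ?_
  exact lintegral_dirac' _ (hF.comp measurable_prodMk_left)

instance (M : MDP dS dA H) : IsMarkovKernel M.generative :=
  ⟨fun q => ⟨by
    have := M.trans_markov q.2
    have h := M.lintegral_generative q (F := fun _ => 1) measurable_const
    simpa using h⟩⟩

/-! ### Likelihood ratio and relative entropy of biased and fair coins -/

namespace CoinData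

/-- The likelihood ratio of one answer for the biases `b` and `0`. -/
def ratio (S : CoinData dS) (b : Bias dS dA)
    (x : ((Cube dS × Cube dA) × Fin H) × (Cube dS × ℝ)) : ℝ :=
  open Classical in
  if (x.1.2 : ℕ) = 0 then
    if x.2.1 = S.heads then 1 + 2 * b.toFun x.1.1 else 1 - 2 * b.toFun x.1.1
  else 1

theorem measurable_ratio (S : CoinData dS) (b : Bias dS dA) :
    Measurable (S.ratio (H := H) b) := by
  have hb : Measurable fun x : ((Cube dS × Cube dA) × Fin H) × (Cube dS × ℝ) => b.toFun x.1.1 :=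
    b.measurable_toFun.comp measurable_fst.fst
  refine Measurable.ite ?_ (Measurable.ite ?_ ((hb.const_mul 2).const_add 1)
    ((hb.const_mul 2).const_sub 1)) measurable_const
  · exact measurable_fst.snd (MeasurableSet.of_discrete (s := {h : Fin H | (h : ℕ) = 0}))
  · exact measurable_snd.fst (measurableSet_singleton S.heads)

theorem ratio_pos (S : CoinData dS) (b : Bias dS dA)
    (x : ((Cube dS × Cube dA) × Fin H) × (Cube dS × ℝ)) : 0 < S.ratio b x := by
  have h1 := b.nonneg x.1.1
  have h2 := b.le_quarter x.1.1
  unfold ratio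
  split_ifs <;> linarith

theorem ratio_of_ne_zero (S : CoinData dS) (b : Bias dS dA)
    {x : ((Cube dS × Cube dA) × Fin H) × (Cube dS × ℝ)} (hx : (x.1.2 : ℕ) ≠ 0) :
    S.ratio b x = 1 := if_neg hx

theorem ratio_heads (S : CoinData dS) (b : Bias dS dA) {q : (Cube dS × Cube dA) × Fin H}
    (hq : (q.2 : ℕ) = 0) (r : ℝ) : S.ratio b (q, (S.heads, r)) = 1 + 2 * b.toFun q.1 := by
  simp [ratio, hq]

theorem ratio_tails (S : CoinData dS) (b : Bias dS dA) {q : (Cube dS × Cube dA) × Fin H}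
    (hq : (q.2 : ℕ) = 0) (r : ℝ) : S.ratio b (q, (S.tails, r)) = 1 - 2 * b.toFun q.1 := by
  simp [ratio, hq, S.heads_ne_tails.symm]

/-- Rewards and later transitions do not depend on the bias, so only queries at the first stage have
a ratio other than `1`. -/
theorem lintegral_generative_eq_ratio (S : CoinData dS) (b : Bias dS dA)
    (q : (Cube dS × Cube dA) × Fin H) {F : Cube dS × ℝ → ENNReal} (hF : Measurable F) :
    ∫⁻ y, F y ∂((S.toMDP H b).generative q)
      = ∫⁻ y, F y * ENNReal.ofReal (S.ratio b (q, y))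
          ∂((S.toMDP H (0 : Bias dS dA)).generative q) := by
  have hr : Measurable fun y => F y * ENNReal.ofReal (S.ratio b (q, y)) :=
    hF.mul ((S.measurable_ratio b).comp measurable_prodMk_left).ennreal_ofReal
  rw [MDP.lintegral_generative _ _ hF, MDP.lintegral_generative _ _ hr]
  by_cases hq : (q.2 : ℕ) = 0
  · have h1 := b.nonneg q.1
    have h2 := b.le_quarter q.1
    rw [S.toMDP_trans_zero _ hq, S.toMDP_trans_zero _ hq, lintegral_toss, lintegral_toss,
      S.ratio_heads b hq, S.ratio_tails b hq]
    have e1 : ENNReal.ofReal (1 / 2 + b.toFun q.1)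
        = ENNReal.ofReal (1 / 2) * ENNReal.ofReal (1 + 2 * b.toFun q.1) := by
      rw [← ENNReal.ofReal_mul (by norm_num)]; congr 1; ring
    have e2 : ENNReal.ofReal (1 / 2 - b.toFun q.1)
        = ENNReal.ofReal (1 / 2) * ENNReal.ofReal (1 - 2 * b.toFun q.1) := by
      rw [← ENNReal.ofReal_mul (by norm_num)]; congr 1; ring
    rw [e1, e2]
    simp only [Bias.zero_toFun, add_zero, sub_zero]
    change _ * F (S.heads, (S.toMDP H (0 : Bias dS dA)).reward q.2 q.1)
      + _ * F (S.tails, (S.toMDP H (0 : Bias dS dA)).reward q.2 q.1) = _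
    ring
  · rw [S.toMDP_trans_of_ne_zero _ hq, S.toMDP_trans_of_ne_zero _ hq]
    simp only [S.ratio_of_ne_zero b (x := (q, _)) hq, ENNReal.ofReal_one, mul_one]
    rfl

theorem lintegral_generative_cost_le (S : CoinData dS) (b : Bias dS dA)
    (q : (Cube dS × Cube dA) × Fin H) {c : ℝ} (hc : 0 < c) :
    ∫⁻ y, ENNReal.ofReal (c * S.ratio b (q, y) - 1 - Real.log (c * S.ratio b (q, y)))
        ∂((S.toMDP H (0 : Bias dS dA)).generative q)
      ≤ ENNReal.ofReal (c - 1 - Real.log c)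
        + ENNReal.ofReal (if (q.2 : ℕ) = 0 then 3 * b.toFun q.1 ^ 2 else 0) := by
  have hr : Measurable fun y => c * S.ratio b (q, y) :=
    ((S.measurable_ratio b).comp measurable_prodMk_left).const_mul c
  refine (MDP.lintegral_generative _ _
    ((hr.sub_const 1).sub hr.log).ennreal_ofReal).trans_le ?_
  simp only [Pi.sub_apply]
  have hpos : ∀ u : ℝ, 0 < u → 0 ≤ u - 1 - Real.log u := fun u hu => by
    linarith [Real.log_le_sub_one_of_pos hu]
  by_cases hq : (q.2 : ℕ) = 0
  · have h1 := b.nonneg q.1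
    have h2 := b.le_quarter q.1
    rw [S.toMDP_trans_zero _ hq, lintegral_toss, S.ratio_heads b hq, S.ratio_tails b hq, if_pos hq]
    set x := b.toFun q.1
    have hp : 0 < 1 + 2 * x := by linarith
    have hm : 0 < 1 - 2 * x := by linarith
    simp only [Bias.zero_toFun, add_zero, sub_zero]
    rw [← ENNReal.ofReal_mul (by norm_num), ← ENNReal.ofReal_mul (by norm_num),
      ← ENNReal.ofReal_add (mul_nonneg (by norm_num) (hpos _ (by positivity)))
        (mul_nonneg (by norm_num) (hpos _ (by positivity))),
      ← ENNReal.ofReal_add (hpos c hc) (by positivity)]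
    refine ENNReal.ofReal_le_ofReal ?_
    rw [Real.log_mul hc.ne' hp.ne', Real.log_mul hc.ne' hm.ne']
    -- The linear terms cancel, and the cost of the toss is `-(1/2) * log (1 - 4 * x ^ 2)`. It is at
    -- most `3 * x ^ 2` because `x ≤ 1/4`.
    have hlog : Real.log (1 + 2 * x) + Real.log (1 - 2 * x) = Real.log (1 - 4 * x ^ 2) := by
      rw [← Real.log_mul hp.ne' hm.ne']; congr 1; ring
    have hx2 : x ^ 2 ≤ 1 / 16 := by nlinarith
    have hu : 0 < 1 - 4 * x ^ 2 := by linarith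
    have h3 := Real.one_sub_inv_le_log_of_pos hu
    have h4 : (1 - 4 * x ^ 2)⁻¹ ≤ 1 + 6 * x ^ 2 := by
      rw [inv_le_iff_one_le_mul₀ hu]
      nlinarith [sq_nonneg x]
    linarith
  · rw [S.toMDP_trans_of_ne_zero _ hq]
    simp [S.ratio_of_ne_zero b (x := (q, _)) hq, hq]

/-- The information that a run of the algorithm collects on the bias `b`. -/
def info (b : Bias dS dA) {n : ℕ} {Ω : Type*} [MeasurableSpace Ω]
    (alg : Algorithm dS dA H n Ω) (t : Fin n) (x : Hist Ω (Cube dS × ℝ) t) : ENNReal :=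
  ENNReal.ofReal
    (if ((alg.query t x).2 : ℕ) = 0 then 3 * b.toFun (alg.query t x).1 ^ 2 else 0)

theorem measurable_info (b : Bias dS dA) {n : ℕ} {Ω : Type*} [MeasurableSpace Ω]
    (alg : Algorithm dS dA H n Ω) (t : Fin n) : Measurable (info b alg t) := by
  have hq := alg.query_measurable t
  refine (Measurable.ite ?_ ((b.measurable_toFun.comp hq.fst).pow_const 2 |>.const_mul 3)
    measurable_const).ennreal_ofReal
  exact hq.snd (MeasurableSet.of_discrete (s := {h : Fin H | (h : ℕ) = 0}))

theorem law_le (S : CoinData dS) (b : Bias dS dA) {n : ℕ} {Ω : Type*} [MeasurableSpace Ω]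
    (alg : Algorithm dS dA H n Ω) {E : Set (Hist Ω (Cube dS × ℝ) n)} (hE : MeasurableSet E) :
    alg.law (S.toMDP H b) E ≤ 2 * alg.law (S.toMDP H (0 : Bias dS dA)) E
      + 2 * ∫⁻ x, cumulCost (info b alg) n le_rfl x
          ∂(alg.law (S.toMDP H (0 : Bias dS dA))) := by
  have := alg.seed_prob
  refine histLaw_le_of_cost alg.seed (fun t => inferInstance) (fun t => inferInstance)
    (ℓ := fun t x => S.ratio b (alg.query t x.1, x.2)) (fun t => ?_) (fun t x => ratio_pos S b _)
    (measurable_info b alg) (fun t x F hF => ?_) (fun t x c hc => ?_) n le_rfl hE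
  · exact (S.measurable_ratio b).comp
      (((alg.query_measurable t).comp measurable_fst).prodMk measurable_snd)
  · exact S.lintegral_generative_eq_ratio b (alg.query t x) hF
  · exact S.lintegral_generative_cost_le b (alg.query t x) hc

end CoinData

/-! ### The value of a policy in the coin process -/

theorem MDP.measurable_totalReward (M : MDP dS dA H) :
    (k : ℕ) → (h : k ≤ H) → Measurable (M.totalReward k h)
  | 0, _ => measurable_const
  | k + 1, h => by
    have h1 := M.measurable_totalReward k (Nat.le_of_succ_le h)
    have h2 : Measurable fun x : Hist (Cube dS) (Cube dA × Cube dS) k × (Cube dA × Cube dS) =>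
        M.totalReward k (Nat.le_of_succ_le h) x.1 + M.reward ⟨k, h⟩ (lastState k x.1, x.2.1) :=
      (h1.comp measurable_fst).add ((M.reward_measurable _).comp
        (((measurable_lastState k).comp measurable_fst).prodMk measurable_snd.fst))
    exact h2

theorem MDP.totalReward_nonneg (M : MDP dS dA H) :
    (k : ℕ) → (h : k ≤ H) → ∀ x, 0 ≤ M.totalReward k h x
  | 0, _, _ => le_rfl
  | k + 1, _, x => add_nonneg (M.totalReward_nonneg k _ x.1) (M.reward_mem _ _).1

instance (M : MDP dS dA H) (π : Policy dS dA H) (h : Fin H) :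
    IsMarkovKernel (M.stepKernel π h) := by
  have := M.trans_markov h
  have := π.act_markov h
  unfold MDP.stepKernel
  infer_instance

/-- The law of the first `k` stages of the trajectory. -/
def MDP.partialLaw (M : MDP dS dA H) (π : Policy dS dA H) (s : Cube dS) (k : ℕ) (h : k ≤ H) :
    Measure (Hist (Cube dS) (Cube dA × Cube dS) k) :=
  histLaw (Measure.dirac s)
    (fun h : Fin H => (M.stepKernel π h).comap (lastState (h : ℕ)) (measurable_lastState _)) k h

instance (M : MDP dS dA H) (π : Policy dS dA H) (s : Cube dS) (k : ℕ) (h : k ≤ H) :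
    IsProbabilityMeasure (M.partialLaw π s k h) :=
  isProbabilityMeasure_histLaw _ _ (fun _ => inferInstance) k h

theorem MDP.lintegral_partialLaw_succ (M : MDP dS dA H) (π : Policy dS dA H) (s : Cube dS)
    (k : ℕ) (h : k + 1 ≤ H)
    {F : Hist (Cube dS) (Cube dA × Cube dS) k × (Cube dA × Cube dS) → ENNReal}
    (hF : Measurable F) :
    ∫⁻ x, F x ∂(M.partialLaw π s (k + 1) h) =
      ∫⁻ x, ∫⁻ a, ∫⁻ s', F (x, (a, s')) ∂(M.trans ⟨k, h⟩ (lastState k x, a))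
        ∂(π.act ⟨k, h⟩ (lastState k x)) ∂(M.partialLaw π s k (Nat.le_of_succ_le h)) := by
  have := M.trans_markov ⟨k, h⟩
  have := π.act_markov ⟨k, h⟩
  have e : ∫⁻ x, F x ∂(M.partialLaw π s (k + 1) h) =
      ∫⁻ x, ∫⁻ y, F (x, y) ∂(((M.stepKernel π ⟨k, h⟩).comap (lastState k)
        (measurable_lastState k)) x) ∂(M.partialLaw π s k (Nat.le_of_succ_le h)) :=
    Measure.lintegral_compProd (μ := M.partialLaw π s k (Nat.le_of_succ_le h)) hF
  refine e.trans (lintegral_congr fun x => ?_)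
  exact Kernel.lintegral_compProd _ _ _ (hF.comp measurable_prodMk_left)

theorem MDP.lintegral_partialLaw_succ_fst (M : MDP dS dA H) (π : Policy dS dA H) (s : Cube dS)
    (k : ℕ) (h : k + 1 ≤ H) {F : Hist (Cube dS) (Cube dA × Cube dS) k → ENNReal}
    (hF : Measurable F) :
    ∫⁻ x, F x.1 ∂(M.partialLaw π s (k + 1) h) =
      ∫⁻ x, F x ∂(M.partialLaw π s k (Nat.le_of_succ_le h)) := by
  have := M.trans_markov ⟨k, h⟩
  have := π.act_markov ⟨k, h⟩
  refine (M.lintegral_partialLaw_succ π s k h (hF.comp measurable_fst)).trans ?_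
  simp

namespace CoinData

/-- The mean bias of the first action of a policy. -/
def meanBias (b : Bias dS dA) (π : Policy dS dA H) (hH : 0 < H) (s : Cube dS) : ℝ :=
  ∫ a, b.toFun (s, a) ∂(π.act ⟨0, hH⟩ s)

theorem integrable_bias (b : Bias dS dA) (s : Cube dS) (ν : Measure (Cube dA))
    [IsProbabilityMeasure ν] : Integrable (fun a => b.toFun (s, a)) ν :=
  Integrable.of_bound (b.measurable_toFun.comp measurable_prodMk_left).aestronglyMeasurable
    (1 / 4) (Filter.Eventually.of_forall fun a => by
      rw [Real.norm_eq_abs, abs_of_nonneg (b.nonneg _)]; exact b.le_quarter _)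

theorem meanBias_mem (b : Bias dS dA) (π : Policy dS dA H) (hH : 0 < H) (s : Cube dS) :
    meanBias b π hH s ∈ Set.Icc (0 : ℝ) (1 / 4) := by
  have := π.act_markov ⟨0, hH⟩
  refine ⟨integral_nonneg fun a => b.nonneg _, ?_⟩
  calc _ ≤ ∫ _, (1 / 4 : ℝ) ∂(π.act ⟨0, hH⟩ s) :=
        integral_mono (integrable_bias b s _) (integrable_const _) fun a => b.le_quarter _
    _ = _ := by simp

variable (S : CoinData dS) (b : Bias dS dA) (π : Policy dS dA H) (s : Cube dS)

/-- Actions after the first have no effect on the motion, so averaging over the first action leaves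
only its mean bias. -/
theorem lintegral_lastState (hH : 0 < H) {F : Cube dS → ENNReal} (hF : Measurable F) :
    (k : ℕ) → (h : k + 1 ≤ H) →
      ∫⁻ x, F (lastState (k + 1) x) ∂((S.toMDP H b).partialLaw π s (k + 1) h) =
        ENNReal.ofReal (1 / 2 + meanBias b π hH s) * F (S.next^[k] S.heads)
          + ENNReal.ofReal (1 / 2 - meanBias b π hH s) * F (S.next^[k] S.tails)
  | 0, h => by
    have := π.act_markov ⟨0, hH⟩
    have hm : Measurable fun x : Hist (Cube dS) (Cube dA × Cube dS) 0 × (Cube dA × Cube dS) =>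
      F x.2.2 := hF.comp measurable_snd.snd
    refine ((S.toMDP H b).lintegral_partialLaw_succ π s 0 h hm).trans ?_
    have hb : Measurable fun a => b.toFun (s, a) := b.measurable_toFun.comp measurable_prodMk_left
    have hint := integrable_bias b s (π.act ⟨0, hH⟩ s)
    have h1 : ∫⁻ a, ENNReal.ofReal (1 / 2 + b.toFun (s, a)) ∂(π.act ⟨0, hH⟩ s)
        = ENNReal.ofReal (1 / 2 + meanBias b π hH s) := by
      refine (ofReal_integral_eq_lintegral_ofReal ((integrable_const _).add hint)
        (Filter.Eventually.of_forall fun a =>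
          add_nonneg (by norm_num : (0 : ℝ) ≤ 1 / 2) (b.nonneg _))).symm.trans ?_
      rw [integral_add' (integrable_const _) hint]
      simp [meanBias]
    have h2 : ∫⁻ a, ENNReal.ofReal (1 / 2 - b.toFun (s, a)) ∂(π.act ⟨0, hH⟩ s)
        = ENNReal.ofReal (1 / 2 - meanBias b π hH s) := by
      refine (ofReal_integral_eq_lintegral_ofReal ((integrable_const _).sub hint)
        (Filter.Eventually.of_forall fun a => sub_nonneg.2
          ((b.le_quarter _).trans (by norm_num : (1 / 4 : ℝ) ≤ 1 / 2)))).symm.trans ?_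
      rw [integral_sub' (integrable_const _) hint]
      simp [meanBias]
    have h3 : Measurable fun s => ∫⁻ a, ∫⁻ s', F s' ∂(S.toss b (s, a)) ∂(π.act ⟨0, hH⟩ s) := by
      have : Measurable fun q => ∫⁻ s', F s' ∂(S.toss b q) := hF.lintegral_kernel
      exact this.lintegral_kernel_prod_right'
    refine (lintegral_dirac' s h3).trans ?_
    simp only [lintegral_toss, Function.iterate_zero, id_eq]
    rw [lintegral_add_left ((hb.const_add _).ennreal_ofReal.mul_const _),
      lintegral_mul_const _ (hb.const_add _).ennreal_ofReal,
      lintegral_mul_const _ (hb.const_sub _).ennreal_ofReal, h1, h2]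
  | k + 1, h => by
    have := π.act_markov ⟨k + 1, h⟩
    have hm : Measurable fun x : Hist (Cube dS) (Cube dA × Cube dS) (k + 1) ×
      (Cube dA × Cube dS) => F x.2.2 := hF.comp measurable_snd.snd
    refine ((S.toMDP H b).lintegral_partialLaw_succ π s (k + 1) h hm).trans ?_
    rw [S.toMDP_trans_of_ne_zero b (h := ⟨k + 1, h⟩) (Nat.succ_ne_zero k)]
    simp only [move_apply, lintegral_dirac' _ hF, lintegral_const, measure_univ, mul_one]
    refine (lintegral_lastState hH (hF.comp S.measurable_next) k (Nat.le_of_succ_le h)).trans ?_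
    simp only [Function.comp_apply, Function.iterate_succ_apply']

theorem totalReward_eq_zero : (k : ℕ) → (h : k ≤ H) → k ≤ S.idx →
    ∀ x, (S.toMDP H b).totalReward k h x = 0
  | 0, _, _, _ => rfl
  | k + 1, h, hk, x => by
    have h1 := totalReward_eq_zero k (Nat.le_of_succ_le h) (Nat.le_of_succ_le hk) x.1
    have h2 : (S.toMDP H b).reward ⟨k, h⟩ (lastState k x.1, x.2.1) = 0 := if_neg (by simp; omega)
    rw [MDP.totalReward, h1, h2, add_zero]

theorem lintegral_totalReward (hH : 0 < H) (hidx : 1 ≤ S.idx) :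
    (k : ℕ) → (h : k ≤ H) → S.idx < k →
      ∫⁻ x, ENNReal.ofReal ((S.toMDP H b).totalReward k h x)
          ∂((S.toMDP H b).partialLaw π s k h) =
        ENNReal.ofReal (1 / 2 + meanBias b π hH s)
            * ENNReal.ofReal (S.rew (S.next^[S.idx - 1] S.heads))
          + ENNReal.ofReal (1 / 2 - meanBias b π hH s)
            * ENNReal.ofReal (S.rew (S.next^[S.idx - 1] S.tails))
  | 0, _, hk => absurd hk (Nat.not_lt_zero _)
  | k + 1, h, hk => by
    have hstep : ∀ G : Hist (Cube dS) (Cube dA × Cube dS) k → ENNReal, Measurable G →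
        (∀ x : Hist (Cube dS) (Cube dA × Cube dS) (k + 1),
          ENNReal.ofReal ((S.toMDP H b).totalReward (k + 1) h x) = G x.1) →
        ∫⁻ x, ENNReal.ofReal ((S.toMDP H b).totalReward (k + 1) h x)
          ∂((S.toMDP H b).partialLaw π s (k + 1) h) =
        ∫⁻ x, G x ∂((S.toMDP H b).partialLaw π s k (Nat.le_of_succ_le h)) := fun G hG hx =>
      (lintegral_congr hx).trans ((S.toMDP H b).lintegral_partialLaw_succ_fst π s k h hG)
    -- Either the newest reward vanishes, being paid after the stage `S.idx`, or it is the only one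
    -- that need not vanish.
    rcases (Nat.lt_succ_iff.1 hk).lt_or_eq with hlt | heq
    · refine (hstep _ ((S.toMDP H b).measurable_totalReward k
        (Nat.le_of_succ_le h)).ennreal_ofReal fun x => ?_).trans
        (lintegral_totalReward hH hidx k (Nat.le_of_succ_le h) hlt)
      have h2 : (S.toMDP H b).reward ⟨k, h⟩ (lastState k x.1, x.2.1) = 0 := if_neg hlt.ne'
      rw [MDP.totalReward, h2, add_zero]
    · have hR : Measurable fun s => ENNReal.ofReal (S.rew s) := S.measurable_rew.ennreal_ofReal
      refine (hstep (fun x => ENNReal.ofReal (S.rew (lastState k x)))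
        (hR.comp (measurable_lastState k)) fun x => ?_).trans ?_
      · have h2 : (S.toMDP H b).reward ⟨k, h⟩ (lastState k x.1, x.2.1)
          = S.rew (lastState k x.1) := if_pos heq.symm
        rw [MDP.totalReward, h2, S.totalReward_eq_zero b k (Nat.le_of_succ_le h) heq.ge x.1,
          zero_add]
      · obtain ⟨j, rfl⟩ : ∃ j, k = j + 1 := ⟨k - 1, by omega⟩
        rw [heq, Nat.add_sub_cancel]
        exact S.lintegral_lastState b π s hH hR j (Nat.le_of_succ_le h)

theorem value_toMDP (hidx : 1 ≤ S.idx) (hH : S.idx < H) :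
    (S.toMDP H b).value π s =
      (1 / 2 + meanBias b π (Nat.zero_lt_of_lt hH) s) * S.rew (S.next^[S.idx - 1] S.heads)
      + (1 / 2 - meanBias b π (Nat.zero_lt_of_lt hH) s)
        * S.rew (S.next^[S.idx - 1] S.tails) := by
  have h := S.lintegral_totalReward b π s (Nat.zero_lt_of_lt hH) hidx H le_rfl hH
  have hm := meanBias_mem b π (Nat.zero_lt_of_lt hH) s
  have e : (S.toMDP H b).value π s = ∫ x, (S.toMDP H b).totalReward H le_rfl x
    ∂((S.toMDP H b).partialLaw π s H le_rfl) := rfl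
  rw [e, integral_eq_lintegral_of_nonneg_ae
    (Filter.Eventually.of_forall ((S.toMDP H b).totalReward_nonneg H le_rfl))
    ((S.toMDP H b).measurable_totalReward H le_rfl).aestronglyMeasurable, h]
  have p1 : 0 ≤ 1 / 2 + meanBias b π (Nat.zero_lt_of_lt hH) s := by linarith [hm.1]
  have p2 : 0 ≤ 1 / 2 - meanBias b π (Nat.zero_lt_of_lt hH) s := by linarith [hm.2]
  rw [← ENNReal.ofReal_mul p1, ← ENNReal.ofReal_mul p2, ← ENNReal.ofReal_add
    (mul_nonneg p1 (S.rew_mem _).1) (mul_nonneg p2 (S.rew_mem _).1), ENNReal.toReal_ofReal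
    (add_nonneg (mul_nonneg p1 (S.rew_mem _).1) (mul_nonneg p2 (S.rew_mem _).1))]

end CoinData

/-! ### Lipschitz constants of the coin process -/

theorem wasserstein_le {X : Type*} [PseudoEMetricSpace X] [MeasurableSpace X] {μ ν : Measure X}
    {C : ℝ} (h : ∀ f : X → ℝ, LipschitzWith 1 f → ∫ x, f x ∂μ - ∫ x, f x ∂ν ≤ C) :
    wasserstein μ ν ≤ C :=
  have : Nonempty {f : X → ℝ // LipschitzWith 1 f} := ⟨⟨fun _ => 0, LipschitzWith.const' 0⟩⟩
  ciSup_le fun f => h f.1 f.2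

theorem CoinData.integral_toss (S : CoinData dS) (b : Bias dS dA) (q : Cube dS × Cube dA)
    (f : Cube dS → ℝ) :
    ∫ s, f s ∂(S.toss b q) = (1 / 2 + b.toFun q) * f S.heads
      + (1 / 2 - b.toFun q) * f S.tails := by
  have h1 := b.nonneg q
  have h2 := b.le_quarter q
  rw [toss_apply, integral_add_measure, integral_smul_measure, integral_smul_measure,
    integral_dirac, integral_dirac, ENNReal.toReal_ofReal (by linarith),
    ENNReal.toReal_ofReal (by linarith), smul_eq_mul, smul_eq_mul]
  · exact (integrable_dirac (by simp)).smul_measure ENNReal.ofReal_ne_top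
  · exact (integrable_dirac (by simp)).smul_measure ENNReal.ofReal_ne_top

/-- Two tosses integrate a test function `f` with difference (difference of biases) times `f heads -
f tails`. Hence only the product `κ * dist S.heads S.tails` matters, and close outcomes allow a
steep bias. -/
theorem CoinData.isLipschitz_toMDP (S : CoinData dS) (b : Bias dS dA) {Lp Lr κ : ℝ}
    (hLp : 0 ≤ Lp) (hLr : 0 ≤ Lr)
    (hb : ∀ s s' a a', |b.toFun (s, a) - b.toFun (s', a')| ≤ κ * (dist s s' + dist a a'))
    (hκ : κ * dist S.heads S.tails ≤ Lp)
    (hnext : ∀ s s', dist (S.next s) (S.next s') ≤ Lp * dist s s')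
    (hrew : ∀ s s', |S.rew s - S.rew s'| ≤ Lr * dist s s') :
    (S.toMDP H b).IsLipschitz Lp Lr where
  reward_le h s s' a a' := by
    have e : ∀ q, (S.toMDP H b).reward h q = if (h : ℕ) = S.idx then S.rew q.1 else 0 :=
      fun _ => rfl
    simp only [e]
    split_ifs
    · refine (hrew s s').trans ?_
      gcongr
      exact le_add_of_nonneg_right dist_nonneg
    · simp only [sub_self, abs_zero]
      positivity
  trans_le h s s' a a' := by
    refine wasserstein_le fun f hf => ?_
    have hf' : ∀ x y, |f x - f y| ≤ dist x y := fun x y => by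
      simpa [Real.dist_eq] using hf.dist_le_mul x y
    by_cases hh : (h : ℕ) = 0
    · rw [S.toMDP_trans_zero b hh, integral_toss, integral_toss]
      have hd : 0 ≤ dist s s' + dist a a' := by positivity
      calc _ = (b.toFun (s, a) - b.toFun (s', a')) * (f S.heads - f S.tails) := by ring
        _ ≤ |b.toFun (s, a) - b.toFun (s', a')| * |f S.heads - f S.tails| := by
            rw [← abs_mul]; exact le_abs_self _
        _ ≤ (κ * (dist s s' + dist a a')) * dist S.heads S.tails :=
            mul_le_mul (hb _ _ _ _) (hf' _ _) (abs_nonneg _) ((abs_nonneg _).trans (hb _ _ _ _))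
        _ = (κ * dist S.heads S.tails) * (dist s s' + dist a a') := by ring
        _ ≤ _ := by gcongr
    · rw [S.toMDP_trans_of_ne_zero b hh, move_apply, move_apply, integral_dirac, integral_dirac]
      refine (le_abs_self _).trans ((hf' _ _).trans ((hnext s s').trans ?_))
      gcongr
      exact le_add_of_nonneg_right dist_nonneg

/-! ### Bumps -/

/-- The bias which is a bump of height `X` and slope `κ` around a state and an action. -/
def bump (X κ : ℝ) (hX : X ≤ 1 / 4) (hκ : 0 ≤ κ) (c : Cube dS × Cube dA) : Bias dS dA where
  toFun q := max 0 (X - κ * (dist q.1 c.1 + dist q.2 c.2))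
  measurable_toFun := by
    have : Continuous fun q : Cube dS × Cube dA =>
      max 0 (X - κ * (dist q.1 c.1 + dist q.2 c.2)) := by fun_prop
    exact this.measurable
  nonneg q := le_max_left _ _
  le_quarter q := max_le (by norm_num) (by
    have : 0 ≤ κ * (dist q.1 c.1 + dist q.2 c.2) := by positivity
    linarith)

section Bump

variable {X κ : ℝ} (hX : X ≤ 1 / 4) (hκ : 0 ≤ κ) (c : Cube dS × Cube dA)

theorem bump_lipschitz (s s' : Cube dS) (a a' : Cube dA) :
    |(bump X κ hX hκ c).toFun (s, a) - (bump X κ hX hκ c).toFun (s', a')|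
      ≤ κ * (dist s s' + dist a a') := by
  refine (abs_max_sub_max_le_max _ _ _ _).trans ?_
  have h1 := abs_dist_sub_le s s' c.1
  have h2 := abs_dist_sub_le a a' c.2
  refine max_le (by simp; positivity) ?_
  calc _ = κ * |(dist s c.1 - dist s' c.1) + (dist a c.2 - dist a' c.2)| := by
        rw [← abs_of_nonneg hκ, ← abs_mul, abs_of_nonneg hκ, ← abs_neg]; congr 1; ring
    _ ≤ _ := by
        gcongr
        exact (abs_add_le _ _).trans (add_le_add h1 h2)

theorem bump_le (hX0 : 0 ≤ X) (q : Cube dS × Cube dA) : (bump X κ hX hκ c).toFun q ≤ X :=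
  max_le hX0 (by
    have : 0 ≤ κ * (dist q.1 c.1 + dist q.2 c.2) := by positivity
    linarith)

theorem bump_center (hX0 : 0 ≤ X) : (bump X κ hX hκ c).toFun c = X := by
  simp [bump, hX0]

theorem lt_of_bump_ne_zero {q : Cube dS × Cube dA} (h : (bump X κ hX hκ c).toFun q ≠ 0) :
    κ * dist q.1 c.1 < X ∧ κ * dist q.2 c.2 < X := by
  have h1 : 0 < X - κ * (dist q.1 c.1 + dist q.2 c.2) := by
    by_contra! h0
    exact h (max_eq_left h0)
  have h2 : 0 ≤ κ * dist q.1 c.1 := by positivity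
  have h3 : 0 ≤ κ * dist q.2 c.2 := by positivity
  constructor <;> linarith

end Bump

/-- The policy that always plays the action `a`. -/
def constPolicy (dS H : ℕ) (a : Cube dA) : Policy dS dA H where
  act _ := Kernel.const _ (Measure.dirac a)
  act_markov _ := inferInstance

-- Always playing the action of the centre gains `ρ * X = 2 * ε` over a fair coin. An `ε`-optimal
-- policy keeps at least half of this gain, and the bias is at most `X` and vanishes off the ball.
open CoinData in
theorem half_le_of_isEpsOptimal (S : CoinData dS) {X κ ρ ε : ℝ} (hX : X ≤ 1 / 4) (hX0 : 0 < X)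
    (hκ : 0 ≤ κ) (c : Cube dS × Cube dA) (hidx : 1 ≤ S.idx) (hH : S.idx < H)
    (hheads : S.rew (S.next^[S.idx - 1] S.heads) = ρ)
    (htails : S.rew (S.next^[S.idx - 1] S.tails) = 0) (hρ : 0 < ρ) (hρX : ρ * X = 2 * ε)
    {π : Policy dS dA H} (h : (S.toMDP H (bump X κ hX hκ c)).IsEpsOptimal ε π) :
    1 / 2 ≤ π.act ⟨0, Nat.zero_lt_of_lt hH⟩ c.1 {a | κ * dist a c.2 < X} := by
  set b := bump X κ hX hκ c with hb
  have hval : ∀ π : Policy dS dA H, (S.toMDP H b).value π c.1 =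
      (1 / 2 + meanBias b π (Nat.zero_lt_of_lt hH) c.1) * ρ := fun π => by
    rw [S.value_toMDP b π c.1 hidx hH, hheads, htails]; ring
  have hconst : meanBias b (constPolicy dS H c.2) (Nat.zero_lt_of_lt hH) c.1 = X := by
    change ∫ a, b.toFun (c.1, a) ∂(Measure.dirac c.2) = X
    rw [integral_dirac]
    exact bump_center hX hκ c hX0.le
  -- Boundedness is essential: the real supremum of an unbounded set is `0` by default.
  have hbdd : BddAbove (Set.range fun π : Policy dS dA H => (S.toMDP H b).value π c.1) := by
    refine ⟨(1 / 2 + 1 / 4) * ρ, ?_⟩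
    rintro _ ⟨π, rfl⟩
    change (S.toMDP H b).value π c.1 ≤ _
    rw [hval]
    gcongr
    exact (meanBias_mem b π _ c.1).2
  have hopt : (S.toMDP H b).value (constPolicy dS H c.2) c.1 ≤ (S.toMDP H b).optValue c.1 :=
    le_ciSup hbdd (constPolicy dS H c.2)
  have h1 := (le_abs_self _).trans (h c.1)
  rw [hval, hconst] at hopt
  rw [hval] at h1
  have h2 : X / 2 ≤ meanBias b π (Nat.zero_lt_of_lt hH) c.1 := by
    have : ρ * (X / 2) ≤ ρ * meanBias b π (Nat.zero_lt_of_lt hH) c.1 := by linarith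
    exact le_of_mul_le_mul_left this hρ
  have := π.act_markov ⟨0, Nat.zero_lt_of_lt hH⟩
  set ν := π.act ⟨0, Nat.zero_lt_of_lt hH⟩ c.1
  set A : Set (Cube dA) := {a | κ * dist a c.2 < X}
  have hA : MeasurableSet A :=
    measurableSet_lt (Continuous.measurable (by fun_prop)) measurable_const
  have h3 : meanBias b π (Nat.zero_lt_of_lt hH) c.1 ≤ X * ν.real A := by
    calc _ ≤ ∫ a, A.indicator (fun _ => X) a ∂ν := by
          refine integral_mono (integrable_bias b c.1 ν) ((integrable_const X).indicator hA)
            fun a => ?_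
          by_cases ha : a ∈ A
          · simpa [ha] using bump_le hX hκ c hX0.le (c.1, a)
          · simp only [ha, not_false_eq_true, Set.indicator_of_notMem]
            by_contra! h0
            exact ha (lt_of_bump_ne_zero hX hκ c h0.ne').2
      _ = _ := by rw [integral_indicator_const _ hA, smul_eq_mul, mul_comm]
  have h4 : 1 / 2 ≤ ν.real A := by
    have : X * (1 / 2) ≤ X * ν.real A := by linarith
    exact le_of_mul_le_mul_left this hX0
  have h5 := ENNReal.ofReal_le_ofReal h4
  rw [ofReal_measureReal] at h5
  refine le_trans (le_of_eq ?_) h5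
  rw [ENNReal.ofReal_div_of_pos two_pos]
  simp

/-! ### The lower bound for separated families of centres -/

/-- Disjoint supports make at most one summand nonzero at any query. -/
theorem sum_info_le {ι : Type*} [Fintype ι] {X : ℝ} (b : ι → Bias dS dA)
    (hb : ∀ i q, (b i).toFun q ≤ X)
    (hdisj : ∀ i j q, (b i).toFun q ≠ 0 → (b j).toFun q ≠ 0 → i = j) {n : ℕ} {Ω : Type*}
    [MeasurableSpace Ω] (alg : Algorithm dS dA H n Ω) (t : Fin n) (x : Hist Ω (Cube dS × ℝ) t) :
    ∑ i, CoinData.info (b i) alg t x ≤ ENNReal.ofReal (3 * X ^ 2) := by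
  classical
  set q := (alg.query t x).1
  have hle : ∀ i, CoinData.info (b i) alg t x ≤ ENNReal.ofReal (3 * X ^ 2) := fun i => by
    refine ENNReal.ofReal_le_ofReal ?_
    have := hb i q
    have := (b i).nonneg q
    split_ifs
    · gcongr
    · positivity
  have hzero : ∀ i, (b i).toFun q = 0 → CoinData.info (b i) alg t x = 0 := fun i hi => by
    simp only [CoinData.info, ENNReal.ofReal_eq_zero]
    split_ifs
    · change 3 * (b i).toFun q ^ 2 ≤ 0
      simp [hi]
    · exact le_rfl
  by_cases h : ∃ i, (b i).toFun q ≠ 0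
  · obtain ⟨i, hi⟩ := h
    rw [Finset.sum_eq_single_of_mem i (Finset.mem_univ i) fun j _ hj =>
      hzero j (by_contra fun h0 => hj (hdisj j i q h0 hi))]
    exact hle i
  · push Not at h
    rw [Finset.sum_eq_zero fun i _ => hzero i (h i)]
    exact zero_le

theorem not_both_lt_of_separated {E : Type*} [PseudoMetricSpace E] {X κ : ℝ} (hκ : 0 ≤ κ)
    {x y z : E} (h : 2 * X ≤ κ * dist x y) (hx : κ * dist z x < X) : ¬ κ * dist z y < X := by
  intro hy
  have := mul_le_mul_of_nonneg_left (dist_triangle_left x y z) hκ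
  linarith

/-- The change of measure is summed over all pairs of centres. The term `4 * card ι` is what an
uninformed output achieves under the fair coin; the term with `n` is the total information
collected. -/
theorem card_le_of_learns (S : CoinData dS) {X κ ρ ε δ Lp Lr : ℝ} (hX : X ≤ 1 / 4) (hX0 : 0 < X)
    (hκ : 0 ≤ κ) (hidx : 1 ≤ S.idx) (hH : S.idx < H)
    (hheads : S.rew (S.next^[S.idx - 1] S.heads) = ρ)
    (htails : S.rew (S.next^[S.idx - 1] S.tails) = 0) (hρ : 0 < ρ) (hρX : ρ * X = 2 * ε)
    (hLp : 0 ≤ Lp) (hLr : 0 ≤ Lr) (hκ' : κ * dist S.heads S.tails ≤ Lp)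
    (hnext : ∀ s s', dist (S.next s) (S.next s') ≤ Lp * dist s s')
    (hrew : ∀ s s', |S.rew s - S.rew s'| ≤ Lr * dist s s')
    {ι α : Type*} [Fintype ι] [Fintype α] (σ : ι → Cube dS) (τ : α → Cube dA)
    (hσ : ∀ i i', i ≠ i' → 2 * X ≤ κ * dist (σ i) (σ i'))
    (hτ : ∀ j j', j ≠ j' → 2 * X ≤ κ * dist (τ j) (τ j'))
    {n : ℕ} {Ω : Type*} [MeasurableSpace Ω] (alg : Algorithm dS dA H n Ω) (hδ : δ ≤ 1)
    (hlearn : alg.LearnsLipschitz Lp Lr ε δ) :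
    (1 - δ) * (Fintype.card ι * Fintype.card α) ≤ 4 * Fintype.card ι + 6 * X ^ 2 * n := by
  have hH0 : 0 < H := Nat.zero_lt_of_lt hH
  let b : ι × α → Bias dS dA := fun p => bump X κ hX hκ (σ p.1, τ p.2)
  let A : α → Set (Cube dA) := fun j => {a | κ * dist a (τ j) < X}
  have hA : ∀ j, MeasurableSet (A j) := fun j =>
    measurableSet_lt (Continuous.measurable (by fun_prop)) measurable_const
  have hA_disj : Pairwise (Function.onFun Disjoint A) := fun j j' hj =>
    Set.disjoint_left.2 fun a ha => not_both_lt_of_separated hκ (hτ j j' hj) ha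
  let P := alg.law (S.toMDP H (0 : Bias dS dA))
  have : IsProbabilityMeasure P := by
    have := alg.seed_prob
    exact isProbabilityMeasure_histLaw _ _ (fun _ => inferInstance) n le_rfl
  have hout : ∀ i j, Measurable fun x => alg.output ⟨0, hH0⟩ (x, σ i) (A j) := fun i j =>
    ((alg.output ⟨0, hH0⟩).measurable_coe (hA j)).comp measurable_prodMk_right
  -- A measurable event containing the success event of the instance `p`, which itself need not be
  -- measurable.
  let E : ι × α → Set (Hist Ω (Cube dS × ℝ) n) := fun p =>
    {x | 1 / 2 ≤ alg.output ⟨0, hH0⟩ (x, σ p.1) (A p.2)}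
  have hE : ∀ p, MeasurableSet (E p) := fun p => measurableSet_le measurable_const (hout p.1 p.2)
  have h1 : ∀ p, ENNReal.ofReal (1 - δ) ≤
      2 * P (E p) + 2 * ∫⁻ x, cumulCost (CoinData.info (b p) alg) n le_rfl x ∂P := fun p =>
    calc _ ≤ alg.law (S.toMDP H (b p)) {x | (S.toMDP H (b p)).IsEpsOptimal ε (alg.policy x)} :=
          hlearn _ (S.isLipschitz_toMDP (b p) hLp hLr (bump_lipschitz hX hκ _) hκ' hnext hrew)
      _ ≤ alg.law (S.toMDP H (b p)) (E p) := measure_mono fun x hx =>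
          half_le_of_isEpsOptimal S hX hX0 hκ (σ p.1, τ p.2) hidx hH hheads htails hρ hρX hx
      _ ≤ _ := S.law_le (b p) alg (hE p)
  -- Markov's inequality at level `1/2`, together with the total mass `1` that the output spreads
  -- over disjoint action balls.
  have h2 : ∀ i, ∑ j, P (E (i, j)) ≤ 2 := fun i => by
    have hmarkov : ∀ j, P (E (i, j)) ≤ 2 * ∫⁻ x, alg.output ⟨0, hH0⟩ (x, σ i) (A j) ∂P :=
      fun j => by
        have := mul_meas_ge_le_lintegral (μ := P) (hout i j) (1 / 2)
        calc P (E (i, j)) = 2 * (1 / 2 * P (E (i, j))) := by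
              rw [← mul_assoc, ENNReal.mul_div_cancel (by simp) (by simp), one_mul]
          _ ≤ _ := by gcongr
    calc _ ≤ ∑ j, 2 * ∫⁻ x, alg.output ⟨0, hH0⟩ (x, σ i) (A j) ∂P :=
          Finset.sum_le_sum fun j _ => hmarkov j
      _ = 2 * ∫⁻ x, ∑ j, alg.output ⟨0, hH0⟩ (x, σ i) (A j) ∂P := by
          rw [lintegral_finsetSum _ fun j _ => hout i j, Finset.mul_sum]
      _ ≤ 2 * ∫⁻ _, 1 ∂P := by
          gcongr with x
          have := alg.output_markov ⟨0, hH0⟩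
          refine (sum_measure_le_measure_univ (fun j _ => (hA j).nullMeasurableSet)
            fun j _ j' _ hj => (hA_disj hj).aedisjoint).trans ?_
          simp
      _ = 2 := by simp
  have h3 : ∑ p, ∫⁻ x, cumulCost (CoinData.info (b p) alg) n le_rfl x ∂P
      ≤ n * ENNReal.ofReal (3 * X ^ 2) := by
    rw [← lintegral_finsetSum _ fun p _ =>
      measurable_cumulCost (CoinData.measurable_info (b p) alg) n le_rfl]
    refine (lintegral_mono (sum_cumulCost_le (sum_info_le b (X := X) (fun p q => ?_)
      (fun p p' q hp hp' => ?_) alg) n le_rfl)).trans (le_of_eq (by simp))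
    · exact bump_le hX hκ _ hX0.le q
    · have h := lt_of_bump_ne_zero hX hκ _ hp
      have h' := lt_of_bump_ne_zero hX hκ _ hp'
      refine Prod.ext (by_contra fun hne => ?_) (by_contra fun hne => ?_)
      · exact not_both_lt_of_separated hκ (hσ _ _ hne) h.1 h'.1
      · exact not_both_lt_of_separated hκ (hτ _ _ hne) h.2 h'.2
  have h4 : (Fintype.card ι * Fintype.card α : ENNReal) * ENNReal.ofReal (1 - δ)
      ≤ 4 * Fintype.card ι + 2 * (n * ENNReal.ofReal (3 * X ^ 2)) := by
    calc _ = ∑ _p : ι × α, ENNReal.ofReal (1 - δ) := by simp [Fintype.card_prod]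
      _ ≤ ∑ p, (2 * P (E p)
            + 2 * ∫⁻ x, cumulCost (CoinData.info (b p) alg) n le_rfl x ∂P) :=
          Finset.sum_le_sum fun p _ => h1 p
      _ = 2 * ∑ i, ∑ j, P (E (i, j))
            + 2 * ∑ p, ∫⁻ x, cumulCost (CoinData.info (b p) alg) n le_rfl x ∂P := by
          rw [Finset.sum_add_distrib, ← Finset.mul_sum, ← Finset.mul_sum, Fintype.sum_prod_type]
      _ ≤ 2 * ∑ _i : ι, 2 + 2 * (n * ENNReal.ofReal (3 * X ^ 2)) := by
          gcongr with i
          exact h2 i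
      _ = _ := by
          simp only [Finset.sum_const, Finset.card_univ, nsmul_eq_mul]
          ring
  have h5 := ENNReal.toReal_mono (by finiteness) h4
  rw [ENNReal.toReal_add (by finiteness) (by finiteness)] at h5
  simp only [ENNReal.toReal_mul, ENNReal.toReal_natCast, ENNReal.toReal_ofNat] at h5
  rw [ENNReal.toReal_ofReal (by linarith), ENNReal.toReal_ofReal (by positivity)] at h5
  linarith

/-! ### Grids in the cube -/

/-- The point of the cube whose coordinates are the grid points `-1 + 2 p i / N`. -/
def gridPoint {k N : ℕ} (p : Fin k → Fin N) : Cube k :=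
  ⟨WithLp.toLp 2 fun i => -1 + 2 * ((p i : ℕ) / N : ℝ), fun i => by
    have hN : 0 < N := Nat.zero_lt_of_lt (p i).isLt
    have h1 : ((p i : ℕ) / N : ℝ) ≤ 1 :=
      div_le_one_of_le₀ (by exact_mod_cast (p i).isLt.le) (by positivity)
    have h2 : 0 ≤ ((p i : ℕ) / N : ℝ) := by positivity
    constructor <;> simp only <;> linarith⟩

theorem Cube.abs_sub_le_dist {k : ℕ} (s s' : Cube k) (i : Fin k) :
    |s.1 i - s'.1 i| ≤ dist s s' := by
  have := PiLp.norm_apply_le (s.1 - s'.1) i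
  rw [Subtype.dist_eq, dist_eq_norm]
  simpa using this

theorem two_div_le_dist_gridPoint {k N : ℕ} {p p' : Fin k → Fin N} (h : p ≠ p') :
    (2 : ℝ) / N ≤ dist (gridPoint p) (gridPoint p') := by
  obtain ⟨i, hi⟩ := Function.ne_iff.1 h
  have hN : (0 : ℝ) < N := by exact_mod_cast Nat.zero_lt_of_lt (p i).isLt
  refine le_trans ?_ (Cube.abs_sub_le_dist _ _ i)
  have h1 : (1 : ℝ) ≤ |((p i : ℕ) : ℝ) - ((p' i : ℕ) : ℝ)| := by
    have h2 : ((p i : ℕ) : ℤ) - ((p' i : ℕ) : ℤ) ≠ 0 := by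
      intro h0
      exact hi (Fin.ext (by omega))
    exact_mod_cast Int.one_le_abs h2
  calc (2 : ℝ) / N ≤ 2 / N * |((p i : ℕ) : ℝ) - ((p' i : ℕ) : ℝ)| :=
        le_mul_of_one_le_right (by positivity) h1
    _ = |2 / N * (((p i : ℕ) : ℝ) - ((p' i : ℕ) : ℝ))| := by
        rw [abs_mul, abs_of_nonneg (by positivity : (0 : ℝ) ≤ 2 / N)]
    _ = _ := by simp only [gridPoint]; congr 1; ring

/-! ### Expansion along the first axis -/

/-- The point at (the truncation to `[-1,1]` of) `t` on the first axis of the cube. -/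
def axisPoint {k : ℕ} (hk : 0 < k) (t : ℝ) : Cube k :=
  ⟨EuclideanSpace.single ⟨0, hk⟩ (max (-1) (min 1 t)), fun i => by
    by_cases hi : i = ⟨0, hk⟩ <;> simp [hi]⟩

variable {k : ℕ} (hk : 0 < k)

theorem axisPoint_apply {t : ℝ} (h0 : 0 ≤ t) (h1 : t ≤ 1) :
    (axisPoint hk t).1 ⟨0, hk⟩ = t := by
  simp only [axisPoint, PiLp.single_apply, if_true]
  rw [min_eq_right h1, max_eq_right (by linarith)]

theorem dist_axisPoint_le (t t' : ℝ) : dist (axisPoint hk t) (axisPoint hk t') ≤ |t - t'| := by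
  rw [Subtype.dist_eq]
  simp only [axisPoint]
  rw [PiLp.dist_single_same, Real.dist_eq]
  refine (abs_max_sub_max_le_max _ _ _ _).trans (max_le (by simp) ?_)
  refine (abs_min_sub_min_le_max _ _ _ _).trans (max_le (by simp) le_rfl)

/-- Multiplication of the first coordinate by `L`, truncated to the cube. -/
def expand (L : ℝ) (s : Cube k) : Cube k := axisPoint hk (L * s.1 ⟨0, hk⟩)

theorem dist_expand_le {L : ℝ} (hL : 0 ≤ L) (s s' : Cube k) :
    dist (expand hk L s) (expand hk L s') ≤ L * dist s s' := by
  refine (dist_axisPoint_le hk _ _).trans ?_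
  rw [← mul_sub, abs_mul, abs_of_nonneg hL]
  gcongr
  exact Cube.abs_sub_le_dist _ _ _

theorem continuous_expand {L : ℝ} (hL : 0 ≤ L) : Continuous (expand hk L) :=
  (LipschitzWith.of_dist_le_mul (K := ⟨L, hL⟩) (dist_expand_le hk hL)).continuous

theorem iterate_expand {L : ℝ} (hL : 1 ≤ L) {t : ℝ} (ht : 0 ≤ t) :
    ∀ m : ℕ, L ^ m * t ≤ 1 → (expand hk L)^[m] (axisPoint hk t) = axisPoint hk (L ^ m * t)
  | 0, _ => by simp
  | m + 1, h => by
    -- As `L ≥ 1`, the earlier iterates also stay below `1`, so the truncation never acts.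
    have hle : L ^ m * t ≤ L ^ (m + 1) * t := by
      gcongr
      · exact Nat.le_succ m
    rw [Function.iterate_succ_apply', iterate_expand hL ht m (hle.trans h), expand,
      axisPoint_apply hk (by positivity) (hle.trans h), pow_succ]
    congr 1
    ring

/-- The coin of the hard instances: its outcomes have distance `L ^ (-(j - 1))`, and this is
expanded to `1` at the rewarded stage `j`. -/
def hardCoin (L ρ : ℝ) (j : ℕ) (hL : 0 < L) (hρ : ρ ∈ Set.Icc (0 : ℝ) 1)
    (hj : j = 1 ∨ 1 ≤ L) : CoinData k where
  heads := axisPoint hk (L ^ (j - 1))⁻¹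
  tails := axisPoint hk 0
  heads_ne_tails h := by
    have hp : 0 < (L ^ (j - 1))⁻¹ := by positivity
    -- This keeps the heads point from being truncated. For `L < 1` only `j = 1`, without any
    -- expansion, is allowed.
    have hle : (L ^ (j - 1))⁻¹ ≤ 1 := by
      rcases hj with rfl | hj
      · simp
      · exact inv_le_one_of_one_le₀ (one_le_pow₀ hj)
    have := congrArg (fun s : Cube k => s.1 ⟨0, hk⟩) h
    simp only [axisPoint_apply hk hp.le hle, axisPoint_apply hk le_rfl zero_le_one] at this
    exact hp.ne' this
  next := expand hk L
  measurable_next := (continuous_expand hk hL.le).measurable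
  rew s := ρ * |s.1 ⟨0, hk⟩|
  measurable_rew := Continuous.measurable (by fun_prop)
  rew_mem s := by
    have h := abs_le.2 (s.2 ⟨0, hk⟩)
    exact ⟨mul_nonneg hρ.1 (abs_nonneg _), mul_le_one₀ hρ.2 (abs_nonneg _) h⟩
  idx := j

section HardCoin

variable {L ρ : ℝ} {j : ℕ} (hL : 0 < L) (hρ : ρ ∈ Set.Icc (0 : ℝ) 1) (hj : j = 1 ∨ 1 ≤ L)

theorem rew_hardCoin_heads :
    (hardCoin hk L ρ j hL hρ hj).rew ((expand hk L)^[j - 1] (axisPoint hk (L ^ (j - 1))⁻¹))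
      = ρ := by
  have e : (expand hk L)^[j - 1] (axisPoint hk (L ^ (j - 1))⁻¹) = axisPoint hk 1 := by
    rcases hj with rfl | hj
    · simp
    · have h1 : L ^ (j - 1) * (L ^ (j - 1))⁻¹ = 1 := mul_inv_cancel₀ (by positivity)
      rw [iterate_expand hk hj (by positivity) _ h1.le, h1]
  rw [e]
  simp [hardCoin, axisPoint_apply hk zero_le_one le_rfl]

theorem rew_hardCoin_tails :
    (hardCoin hk L ρ j hL hρ hj).rew ((expand hk L)^[j - 1] (axisPoint hk 0)) = 0 := by
  have e : ∀ m, (expand hk L)^[m] (axisPoint hk 0) = axisPoint hk 0 := fun m => by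
    refine Function.iterate_fixed ?_ m
    rw [expand, axisPoint_apply hk le_rfl zero_le_one, mul_zero]
  rw [e]
  simp [hardCoin, axisPoint_apply hk le_rfl zero_le_one]

end HardCoin

/-! ### The sample complexity -/

theorem sampleComplexity_of_stage {dS dA H n j : ℕ} {L₀ δ₀ Lp Lr ε δ : ℝ} (hdS : 1 ≤ dS)
    (hdA : 1 ≤ dA) (hL₀ : 0 < L₀) (hL₀1 : L₀ ≤ 1) (hδ₀ : δ₀ < 1) (hLp : L₀ ≤ Lp) (hLr : L₀ ≤ Lr)
    (hj1 : 1 ≤ j) (hjH : j < H) (hj : j = 1 ∨ 1 ≤ Lp) (hε : 0 < ε)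
    (hε₀ : ε ≤ L₀ ^ 2 * (1 - δ₀) / 32) (hδ0 : 0 < δ) (hδ : δ ≤ δ₀)
    {Ω : Type*} [MeasurableSpace Ω] (alg : Algorithm dS dA H n Ω)
    (hlearn : alg.LearnsLipschitz Lp Lr ε δ) :
    (1 - δ₀) * L₀ ^ 2 / 48 * (L₀ ^ 2 / 4) ^ (dS + dA) * (Lp ^ (j - 1)) ^ (dS + dA)
      / ε ^ (dS + dA + 2) ≤ n := by
  have hLp0 : 0 < Lp := hL₀.trans_le hLp
  set η := 1 - δ₀ with hη
  have hη0 : 0 < η := by linarith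
  have hη1 : η < 1 := by linarith
  set G := Lp ^ (j - 1)
  have hG0 : 0 < G := by positivity
  have hG1 : 1 ≤ G := by
    rcases hj with rfl | hj
    · simp [G]
    · exact one_le_pow₀ hj
  -- The reward has height `ρ = L₀`, so `ρ * X = 2 * ε`. The outcomes lie at distance at most `G⁻¹`,
  -- so the slope `L₀ * G` costs at most `L₀ ≤ Lp` in the Lipschitz constant.
  set X := 2 * ε / L₀ with hXdef
  set κ := L₀ * G with hκdef
  have hX0 : 0 < X := by positivity
  have hX : X ≤ 1 / 4 := by
    rw [hXdef, div_le_iff₀ hL₀]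
    nlinarith
  have hκ0 : 0 < κ := by positivity
  have hratio : κ / X = L₀ ^ 2 * G / (2 * ε) := by
    rw [hXdef, hκdef]; field_simp
  -- This is where the threshold on `ε` is used: it makes the grid so fine that the term `4 * N ^
  -- dS` can be absorbed below.
  have hbig : 16 / η ≤ κ / X := by
    rw [hratio, div_le_div_iff₀ hη0 (by positivity)]
    have : L₀ ^ 2 * η * 1 ≤ L₀ ^ 2 * η * G := by gcongr
    nlinarith
  have h16 : 16 ≤ 16 / η := by rw [le_div_iff₀ hη0]; linarith
  -- The finest grid whose spacing `2 / N` is at least `2 * X / κ`, as disjoint bumps require.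
  set N := ⌊κ / X⌋₊
  have hN_le : (N : ℝ) ≤ κ / X := Nat.floor_le (by positivity)
  have hN_ge : L₀ ^ 2 / 4 * G / ε ≤ N := by
    have h1 := Nat.lt_floor_add_one (κ / X)
    have h2 : L₀ ^ 2 / 4 * G / ε = κ / X / 2 := by rw [hratio]; field_simp; norm_num
    rw [h2]
    change κ / X < N + 1 at h1
    linarith
  have hN8 : 8 / η ≤ N := by
    have h1 := Nat.lt_floor_add_one (κ / X)
    have h2 : 8 / η = 16 / η / 2 := by ring
    change κ / X < N + 1 at h1
    linarith
  have hN1 : (1 : ℝ) ≤ N := by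
    have : 8 ≤ 8 / η := by rw [le_div_iff₀ hη0]; linarith
    linarith
  have hsep : ∀ {k : ℕ} (p p' : Fin k → Fin N), p ≠ p' →
      2 * X ≤ κ * dist (gridPoint p) (gridPoint p') := fun p p' h => by
    calc 2 * X ≤ κ * (2 / N) := by
          rw [le_div_iff₀ hX0] at hN_le
          rw [← mul_div_assoc κ, le_div_iff₀ (by linarith : (0 : ℝ) < N)]
          linarith
      _ ≤ _ := by gcongr; exact two_div_le_dist_gridPoint h
  have hρ : L₀ ∈ Set.Icc (0 : ℝ) 1 := ⟨hL₀.le, hL₀1⟩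
  have hmain := card_le_of_learns (hardCoin hdS Lp L₀ j hLp0 hρ hj) hX hX0 hκ0.le hj1 hjH
    (rew_hardCoin_heads hdS hLp0 hρ hj) (rew_hardCoin_tails hdS hLp0 hρ hj) hL₀
    (show L₀ * X = 2 * ε by rw [hXdef]; field_simp) hLp0.le (hL₀.le.trans hLr)
    (by
      calc κ * dist (axisPoint hdS G⁻¹) (axisPoint hdS 0) ≤ κ * |G⁻¹ - 0| := by
            gcongr; exact dist_axisPoint_le hdS _ _
        _ = L₀ := by
            rw [sub_zero, abs_of_pos (by positivity), hκdef, mul_assoc, mul_inv_cancel₀ hG0.ne',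
              mul_one]
        _ ≤ Lp := hLp)
    (dist_expand_le hdS hLp0.le)
    (fun s s' => by
      change abs (L₀ * |s.1 ⟨0, hdS⟩| - L₀ * |s'.1 ⟨0, hdS⟩|) ≤ _
      rw [← mul_sub, abs_mul, abs_of_pos hL₀]
      have h1 := (abs_abs_sub_abs_le (s.1 ⟨0, hdS⟩) (s'.1 ⟨0, hdS⟩)).trans
        (Cube.abs_sub_le_dist s s' _)
      exact mul_le_mul hLr h1 (abs_nonneg _) (hL₀.le.trans hLr))
    (gridPoint : (Fin dS → Fin N) → Cube dS) (gridPoint : (Fin dA → Fin N) → Cube dA)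
    hsep hsep alg (by linarith) hlearn
  simp only [Fintype.card_fun, Fintype.card_fin, Nat.cast_pow] at hmain
  -- With at least `8 / η` action centres, `4 * N ^ dS` is at most half of `η * N ^ (dS + dA)`; here
  -- `dA ≥ 1` is needed.
  have hNA : 8 / η ≤ (N : ℝ) ^ dA := hN8.trans (le_self_pow₀ hN1 (by omega))
  have hNS : 0 < (N : ℝ) ^ dS := by positivity
  have h8 : 8 * (N : ℝ) ^ dS ≤ η * ((N : ℝ) ^ dS * (N : ℝ) ^ dA) := by
    rw [div_le_iff₀ hη0] at hNA
    nlinarith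
  have hηδ : η * ((N : ℝ) ^ dS * (N : ℝ) ^ dA) ≤ (1 - δ) * ((N : ℝ) ^ dS * (N : ℝ) ^ dA) := by
    gcongr
    linarith
  have hcount : η * (N : ℝ) ^ (dS + dA) ≤ 12 * X ^ 2 * n := by
    rw [pow_add]; linarith
  have hpow : (L₀ ^ 2 / 4 * G / ε) ^ (dS + dA) ≤ (N : ℝ) ^ (dS + dA) := by gcongr
  calc _ = η * L₀ ^ 2 / 48 / ε ^ 2 * (L₀ ^ 2 / 4 * G / ε) ^ (dS + dA) := by
        rw [div_pow (_ * _) ε, mul_pow (_ / _) G, pow_add ε]; field_simp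
    _ ≤ η * L₀ ^ 2 / 48 / ε ^ 2 * (N : ℝ) ^ (dS + dA) := by gcongr
    _ = η * (N : ℝ) ^ (dS + dA) / (12 * X ^ 2) := by rw [hXdef]; field_simp; norm_num
    _ ≤ n := by rw [div_le_iff₀ (by positivity)]; linarith

theorem sampleComplexity (dS dA : ℕ) (L₀ δ₀ : ℝ) (hdS : 1 ≤ dS) (hdA : 1 ≤ dA) (hL₀ : 0 < L₀)
    (hδ₀ : δ₀ < 1) :
    ∃ c ε₀ : ℝ, 0 < c ∧ 0 < ε₀ ∧
      ∀ (Lp Lr ε δ : ℝ) (H n : ℕ), L₀ ≤ Lp → L₀ ≤ Lr → 2 ≤ H →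
        0 < ε → ε ≤ ε₀ → 0 < δ → δ ≤ δ₀ →
        ∀ (Ω : Type*) [MeasurableSpace Ω] (alg : Algorithm dS dA H n Ω),
          alg.LearnsLipschitz Lp Lr ε δ →
            c * Lp ^ ((dS + dA) * (H - 2)) / ε ^ (dS + dA + 2) ≤ (n : ℝ) := by
  have hη : 0 < 1 - δ₀ := by linarith
  -- `L₀` also serves as the height of the reward and must not exceed `1`.
  have hl : 0 < min L₀ 1 := lt_min hL₀ one_pos
  refine ⟨(1 - δ₀) * min L₀ 1 ^ 2 / 48 * (min L₀ 1 ^ 2 / 4) ^ (dS + dA),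
    min L₀ 1 ^ 2 * (1 - δ₀) / 32, by positivity, by positivity, ?_⟩
  intro Lp Lr ε δ H n hLp hLr hH hε hε₀ hδ0 hδ Ω _ alg hlearn
  have hLp0 : 0 < Lp := hL₀.trans_le hLp
  -- For `Lp ≥ 1` the reward waits until the last stage, of index `H - 1`, after `H - 2` expansions.
  -- For `Lp ≤ 1` it is paid right after the toss, and the factor `Lp ^ ((dS + dA) * (H - 2)) ≤ 1`
  -- is simply dropped.
  rcases le_total 1 Lp with h | h
  · have := sampleComplexity_of_stage hdS hdA hl (min_le_right _ _) hδ₀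
      ((min_le_left _ _).trans hLp) ((min_le_left _ _).trans hLr) (j := H - 1) (by omega) (by omega)
      (Or.inr h) hε hε₀ hδ0 hδ alg hlearn
    rwa [← pow_mul, mul_comm (H - 1 - 1), Nat.sub_sub] at this
  · refine le_trans ?_ (sampleComplexity_of_stage hdS hdA hl (min_le_right _ _) hδ₀
      ((min_le_left _ _).trans hLp) ((min_le_left _ _).trans hLr) (j := 1) le_rfl (by omega)
      (Or.inl rfl) hε hε₀ hδ0 hδ alg hlearn)
    rw [Nat.sub_self, pow_zero, one_pow]
    gcongr
    exact pow_le_one₀ hLp0.le h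

end LipMDP

end

theorem mainTheorem5 :
    (∀ (dS dA : ℕ) (L₀ δ₀ : ℝ), 1 ≤ dS → 1 ≤ dA → 0 < L₀ → 0 < δ₀ → δ₀ < 1 →
      ∃ c ε₀ : ℝ, 0 < c ∧ 0 < ε₀ ∧
        ∀ (Lp Lr ε δ : ℝ) (H n : ℕ), L₀ ≤ Lp → L₀ ≤ Lr → 2 ≤ H →
          0 < ε → ε ≤ ε₀ → 0 < δ → δ ≤ δ₀ →
          ∀ (Ω : Type*) [MeasurableSpace Ω] (alg : LipMDP.Algorithm dS dA H n Ω),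
            alg.LearnsLipschitz Lp Lr ε δ →
              c * Lp ^ ((dS + dA) * (H - 2)) / ε ^ (dS + dA + 2) ≤ (n : ℝ)) ∧
    (∀ Lp : ℝ, 1 < Lp → ∃ C : ℝ, 1 < C ∧
      ∀ (dS dA : ℕ) (Lr δ₀ : ℝ), 1 ≤ dS → 1 ≤ dA → 0 < Lr → 0 < δ₀ → δ₀ < 1 →
        ∃ c ε₀ : ℝ, 0 < c ∧ 0 < ε₀ ∧
          ∀ (ε δ : ℝ) (H n : ℕ), 2 ≤ H → 0 < ε → ε ≤ ε₀ → 0 < δ → δ ≤ δ₀ →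
            ∀ (Ω : Type*) [MeasurableSpace Ω] (alg : LipMDP.Algorithm dS dA H n Ω),
              alg.LearnsLipschitz Lp Lr ε δ →
                c * C ^ ((dS + dA) * H) / ε ^ (dS + dA + 2) ≤ (n : ℝ)) := by
  refine ⟨fun dS dA L₀ δ₀ hdS hdA hL₀ _ hδ₀ =>
    LipMDP.sampleComplexity dS dA L₀ δ₀ hdS hdA hL₀ hδ₀, fun Lp hLp => ⟨Lp, hLp, ?_⟩⟩
  intro dS dA Lr δ₀ hdS hdA hLr _ hδ₀
  have hLp0 : 0 < Lp := one_pos.trans hLp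
  obtain ⟨c, ε₀, hc, hε₀, h⟩ :=
    LipMDP.sampleComplexity dS dA (min Lp Lr) δ₀ hdS hdA (lt_min hLp0 hLr) hδ₀
  -- With `C = Lp`, the passage from `H - 2` to `H` costs the factor `Lp ^ ((dS + dA) * 2)`,
  -- independent of `H`.
  refine ⟨c / Lp ^ ((dS + dA) * 2), ε₀, by positivity, hε₀, ?_⟩
  intro ε δ H n hH hε hε' hδ0 hδ Ω _ alg hlearn
  have key := h Lp Lr ε δ H n (min_le_left _ _) (min_le_right _ _) hH hε hε' hδ0 hδ Ω alg hlearn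
  have e : Lp ^ ((dS + dA) * H) = Lp ^ ((dS + dA) * (H - 2)) * Lp ^ ((dS + dA) * 2) := by
    rw [← pow_add, ← mul_add, Nat.sub_add_cancel hH]
  rw [e, div_mul_eq_mul_div, ← mul_assoc, mul_div_cancel_right₀ _ (by positivity)]
  exact key
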